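/- **Setting.** Let $\{e_1,\dots,e_n,e'_1,\dots,e'_n\}$ be the standard orthonormal basis of $\mathbb R^{2n}$, let $\mathbb G_{2n}$ be the real Clifford algebra of $\mathbb R^{2n}$ with $v^2=v\cdot v$ for vectors $v$, with norm $|a|^2=\langle a\,a^\dagger\rangle_0$ ($\dagger$ is the reversion, $\langle\cdot\rangle_0$ the scalar part), and put $B_i=e_ie'_i$. Points of $\mathbb R^{2n}$ are written $\hat y=y+y'$ with $y=\sum y_ie_i$, $y'=\sum y'_ie'_i$, and $|\cdot|$ is the Euclidean norm on $\mathbb R^n$ and $\mathbb R^{2n}$. Let $P_i$ be the projection of $\mathbb R^{2n}$ onto the span of $e_i,e'_i$, and for $x\in\mathbb R^n=\mathrm{span}(e_1,\dots,e_n)$ put $I(x,\hat y)=\sum_i B_iP_i(x)P_i(\hat y)$. Let $dm(x)=(2\pi)^{-n/2}dx$; $L_2$ and $\|\cdot\|_2$ refer to $\mathbb G_{2n}$-valued functions on $\mathbb R^n$ and to $m$, and "vanishes" is meant almost everywhere. For $F\in L_2$ let $$(\mathcal F_1F)(\hat y)=\int_{\mathbb R^n}e^{-I(x,\hat y)}F(x)\,dm(x)$$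 whenever the integral exists. A $C^1$ function $f:\mathbb R^{2n}\to\mathbb G_{2n}$ is monogenic with respect to $B_i$ in $\mathbb R^{2n}$ if $e_i\,\partial f/\partial y_i+e'_i\,\partial f/\partial y'_i=0$ on $\mathbb R^{2n}$. Write $f_{y'}(y)=f(y+y')$. Let $A>0$ and let $B_A$ be the ball of radius $A$ centred at $0$ in $\mathbb R^n$. **Theorem 4.4.** 1. Let $F\in L_2$ vanish outside $B_A$. Then the integral defining $(\mathcal F_1F)(\hat y)$ exists for every $\hat y\in\mathbb R^{2n}$, and $f=\mathcal F_1F$ is monogenic with respect to each $B_i$, $i=1,\dots,n$, in $\mathbb R^{2n}$. Moreover there is a constant $C>0$ with $$|f(\hat y)|\le C\,e^{A|\hat y|}\qquad(\hat y\in\mathbb R^{2n}),$$ and $\|f_{y'}\|_2\le e^{A|y'|}\,\|F\|_2$ for every $y'$. 2. Conversely, let $C>0$ and let $f:\mathbb R^{2n}\to\mathbb G_{2n}$ be monogenic with respect to each $B_i$, $i=1,\dots,n$, in $\mathbb R^{2n}$, with $|f(\hat y)|\le C\,e^{A|\hat y|}$ for all $\hat y\in\mathbb R^{2n}$ and $\|f_{y'}\|_2^2\le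 h(y')<\infty$ for almost every $y'$, where $h$ is a locally integrable function on $\mathbb R^n$. Then there is $F\in L_2$ vanishing outside $B_A$ such that, for every $\hat y\in\mathbb R^{2n}$, the integral defining $(\mathcal F_1F)(\hat y)$ exists and $f(\hat y)=(\mathcal F_1F)(\hat y)$. -/

import Mathlib

open MeasureTheory
open scoped ENNReal

noncomputable section

namespace CliffordFourier

/-- The Euclidean space `ℝⁿ`. -/
abbrev Rn (n : ℕ) : Type := EuclideanSpace ℝ (Fin n)

/-- The Euclidean space `ℝ²ⁿ`. The coordinates indexed by `Sum.inl i` are the unprimed ones,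
those indexed by `Sum.inr i` the primed ones. -/
abbrev R2n (n : ℕ) : Type := EuclideanSpace ℝ (Fin n ⊕ Fin n)

/-- The quadratic form `x ↦ x · x` on `ℝ²ⁿ`. -/
def sqForm (n : ℕ) : QuadraticForm ℝ (R2n n) :=
  LinearMap.BilinMap.toQuadraticMap (innerₗ (R2n n))

/-- The Clifford algebra `𝔾₂ₙ` of `ℝ²ⁿ`, in which `x ^ 2 = x · x` for every vector `x`. -/
abbrev G (n : ℕ) : Type := CliffordAlgebra (sqForm n)

/-- The orthonormal basis `e₁, …, eₙ, e'₁, …, e'ₙ` of `ℝ²ⁿ`. -/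
def basisVec {n : ℕ} (j : Fin n ⊕ Fin n) : R2n n := EuclideanSpace.single j 1

/-- A basis vector of `ℝ²ⁿ` as an element of the Clifford algebra. -/
def gen {n : ℕ} (j : Fin n ⊕ Fin n) : G n := CliffordAlgebra.ι (sqForm n) (basisVec j)

/-- `e_i` as an element of the Clifford algebra. -/
def e {n : ℕ} (i : Fin n) : G n := gen (Sum.inl i)

/-- `e'_i` as an element of the Clifford algebra. -/
def e' {n : ℕ} (i : Fin n) : G n := gen (Sum.inr i)

/-- The scalar part `⟨a⟩₀` of a multivector: its component of degree `0` under the canonical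
linear isomorphism of the Clifford algebra with the exterior algebra. -/
def scalarPart (n : ℕ) : G n →ₗ[ℝ] ℝ :=
  (ExteriorAlgebra.algebraMapInv (R := ℝ) (M := R2n n)).toLinearMap ∘ₗ
    (CliffordAlgebra.equivExterior (sqForm n)).toLinearMap

/-! ### The scalar product `a · b = ⟨a b†⟩₀` is positive definite -/

section Facts

variable {n : ℕ}

instance instLawfulBEqIndex : LawfulBEq (Fin n ⊕ Fin n) where
  eq_of_beq {a b} h := by
    rcases a with a | a <;> rcases b with b | b <;> first | exact congrArg _ (eq_of_beq h) | cases h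
  rfl {a} := by rcases a with a | a <;> exact beq_self_eq_true a

lemma sqForm_apply (x : R2n n) : sqForm n x = inner ℝ x x := rfl

lemma gen_mul_self (j : Fin n ⊕ Fin n) : (gen j * gen j : G n) = 1 := by
  rw [gen, CliffordAlgebra.ι_sq_scalar, sqForm_apply, real_inner_self_eq_norm_sq, basisVec]
  simp

lemma gen_mul_gen {j k : Fin n ⊕ Fin n} (h : j ≠ k) :
    (gen j * gen k : G n) = -(gen k * gen j) := by
  rw [eq_neg_iff_add_eq_zero, gen, gen, CliffordAlgebra.ι_mul_ι_add_swap]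
  have : QuadraticMap.polar (sqForm n) (basisVec j) (basisVec k) = 0 := by
    simp only [QuadraticMap.polar, sqForm_apply, inner_add_left, inner_add_right, basisVec]
    simp [EuclideanSpace.inner_single_left, h, h.symm]
  rw [this, map_zero]

/-- The product of the basis vectors with indices in the list `l`. -/
def listProd (l : List (Fin n ⊕ Fin n)) : G n := (l.map gen).prod

lemma listProd_nil : listProd (n := n) [] = 1 := rfl

lemma listProd_cons (j : Fin n ⊕ Fin n) (l : List (Fin n ⊕ Fin n)) :
    listProd (j :: l) = gen j * listProd l := by simp [listProd]

lemma listProd_append (l l' : List (Fin n ⊕ Fin n)) :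
    listProd (l ++ l') = listProd l * listProd l' := by simp [listProd]

lemma reverse_listProd (l : List (Fin n ⊕ Fin n)) :
    CliffordAlgebra.reverse (listProd l) = listProd l.reverse := by
  induction l with
  | nil => simp [listProd]
  | cons j l ih =>
    rw [listProd_cons, CliffordAlgebra.reverse.map_mul, ih, List.reverse_cons, listProd_append,
      gen, CliffordAlgebra.reverse_ι, listProd_cons, listProd_nil, mul_one, gen]

lemma listProd_perm {l l' : List (Fin n ⊕ Fin n)} (h : l.Perm l') :
    listProd l = listProd l' ∨ listProd l = -listProd l' := by
  induction h with
  | nil => exact Or.inl rfl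
  | cons j _ ih =>
    rw [listProd_cons, listProd_cons]
    rcases ih with ih | ih <;> simp [ih]
  | swap j k l =>
    simp only [listProd_cons, ← mul_assoc]
    by_cases hjk : k = j
    · left; rw [hjk]
    · right; rw [gen_mul_gen hjk, neg_mul]
  | trans _ _ ih ih' =>
    rcases ih with ih | ih <;> rcases ih' with ih' | ih' <;> simp [ih, ih']

/-- Every product of basis vectors is, up to sign, a product of distinct ones, namely of those
which occur an odd number of times. -/
lemma listProd_reduce (l : List (Fin n ⊕ Fin n)) :
    ∃ l' : List (Fin n ⊕ Fin n), l'.Nodup ∧ (∀ j, j ∈ l' ↔ Odd (l.count j)) ∧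
      (listProd l = listProd l' ∨ listProd l = -listProd l') := by
  induction l with
  | nil => exact ⟨[], by simp, by simp, Or.inl rfl⟩
  | cons i l ih =>
    obtain ⟨l', hn, hm, hp⟩ := ih
    by_cases hi : i ∈ l'
    · refine ⟨l'.erase i, hn.erase i, fun j => ?_, ?_⟩
      · rw [hn.mem_erase_iff, hm, List.count_cons]
        by_cases hij : i = j
        · subst hij
          have := (hm i).1 hi
          simp [Nat.odd_add_one, this]
        · simp [hij, Ne.symm hij]
      · have h1 := listProd_perm (List.perm_cons_erase hi)
        rw [listProd_cons] at h1 ⊢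
        rcases hp with hp | hp <;> rcases h1 with h1 | h1 <;>
          simp [hp, h1, ← mul_assoc, gen_mul_self]
    · refine ⟨i :: l', List.nodup_cons.2 ⟨hi, hn⟩, fun j => ?_, ?_⟩
      · rw [List.mem_cons, hm, List.count_cons]
        by_cases hij : i = j
        · subst hij
          have := (not_congr (hm i)).1 hi
          simp [Nat.odd_add_one, this]
        · simp [hij, Ne.symm hij]
      · rw [listProd_cons, listProd_cons]
        rcases hp with hp | hp <;> simp [hp]

lemma equivExterior_listProd {l : List (Fin n ⊕ Fin n)} (h : l.Nodup) :
    CliffordAlgebra.equivExterior (sqForm n) (listProd l) =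
      (l.map fun j => ExteriorAlgebra.ι ℝ (basisVec j)).prod := by
  have key : ∀ (j : Fin n ⊕ Fin n) (l : List (Fin n ⊕ Fin n)), j ∉ l →
      ∀ d : Module.Dual ℝ (R2n n), (∀ k, k ≠ j → d (basisVec k) = 0) →
      CliffordAlgebra.contractLeft d
        ((l.map fun j => CliffordAlgebra.ι (0 : QuadraticForm ℝ (R2n n)) (basisVec j)).prod) =
          0 := by
    intro j l hj d hd
    induction l with
    | nil => simp
    | cons k l ih =>
      rw [List.mem_cons, not_or] at hj
      rw [List.map_cons, List.prod_cons, CliffordAlgebra.contractLeft_ι_mul, ih hj.2,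
        hd k (Ne.symm hj.1)]
      simp
  induction l with
  | nil => simp [listProd, CliffordAlgebra.equivExterior]
  | cons j l ih =>
    rw [List.nodup_cons] at h
    have ih' := ih h.2
    rw [CliffordAlgebra.equivExterior, CliffordAlgebra.changeFormEquiv_apply] at ih' ⊢
    rw [listProd_cons, gen, CliffordAlgebra.changeForm_ι_mul, ih', List.map_cons, List.prod_cons]
    rw [sub_eq_self]
    refine key j l h.1 _ fun k hk => ?_
    simp [sqForm, basisVec, QuadraticMap.associated_apply, inner_add_right,
      EuclideanSpace.inner_single_left, hk, hk.symm]

lemma scalarPart_listProd {l : List (Fin n ⊕ Fin n)} (h : l.Nodup) :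
    scalarPart n (listProd l) = if l = [] then 1 else 0 := by
  have : scalarPart n (listProd l) = ExteriorAlgebra.algebraMapInv
      (CliffordAlgebra.equivExterior (sqForm n) (listProd l)) := rfl
  rw [this, equivExterior_listProd h]
  cases l with
  | nil => simp
  | cons j l =>
    rw [List.map_cons, List.prod_cons, map_mul]
    simp [ExteriorAlgebra.algebraMapInv]

/-- The basis multivector `e_S`, for a set `S` of indices. -/
def blade (S : Finset (Fin n ⊕ Fin n)) : G n := listProd S.toList

lemma listProd_mul_reverse (l : List (Fin n ⊕ Fin n)) :
    listProd l * CliffordAlgebra.reverse (listProd l) = 1 := by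
  induction l with
  | nil => simp [listProd]
  | cons j l ih =>
    rw [listProd_cons, CliffordAlgebra.reverse.map_mul, mul_assoc, ← mul_assoc (listProd l), ih,
      one_mul, gen, CliffordAlgebra.reverse_ι]
    exact gen_mul_self j

/-- The basis multivectors are orthonormal for the scalar product `⟨a b†⟩₀`. -/
lemma scalarPart_blade (S T : Finset (Fin n ⊕ Fin n)) :
    scalarPart n (blade S * CliffordAlgebra.reverse (blade T)) = if S = T then 1 else 0 := by
  by_cases h : S = T
  · subst h
    rw [blade, listProd_mul_reverse, if_pos rfl, ← listProd_nil, scalarPart_listProd (by simp)]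
    simp
  · rw [if_neg h, blade, blade, reverse_listProd, ← listProd_append]
    obtain ⟨l', hn, hm, hp⟩ := listProd_reduce (S.toList ++ T.toList.reverse)
    have hne : l' ≠ [] := by
      rintro rfl
      apply h
      ext j
      have := hm j
      rw [List.count_append, List.count_reverse] at this
      have hS := List.Nodup.count (a := j) S.nodup_toList
      have hT := List.Nodup.count (a := j) T.nodup_toList
      rw [hS, hT] at this
      simp only [Finset.mem_toList] at this
      by_cases h1 : j ∈ S <;> by_cases h2 : j ∈ T <;> simp [h1, h2] at this ⊢
    rcases hp with hp | hp <;> rw [hp] <;> simp [scalarPart_listProd hn, hne]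

/-- The basis multivectors span the Clifford algebra. -/
lemma exists_blade_sum (a : G n) :
    ∃ c : Finset (Fin n ⊕ Fin n) → ℝ, a = ∑ S, c S • blade S := by
  suffices h : a ∈ Submodule.span ℝ (Set.range (blade (n := n))) by
    obtain ⟨c, hc⟩ := (Submodule.mem_span_range_iff_exists_fun ℝ).1 h
    exact ⟨c, hc.symm⟩
  have hl : ∀ l : List (Fin n ⊕ Fin n),
      listProd l ∈ Submodule.span ℝ (Set.range (blade (n := n))) := by
    intro l
    obtain ⟨l', hn, -, hp⟩ := listProd_reduce l
    have h1 : blade l'.toFinset ∈ Submodule.span ℝ (Set.range (blade (n := n))) :=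
      Submodule.subset_span ⟨_, rfl⟩
    have h2 := listProd_perm (List.toFinset_toList hn)
    rw [blade] at h1
    have h3 : listProd l' ∈ Submodule.span ℝ (Set.range (blade (n := n))) := by
      rcases h2 with h2 | h2 <;> rw [h2] at h1
      · exact h1
      · exact (Submodule.neg_mem_iff _).1 h1
    rcases hp with hp | hp <;> rw [hp]
    · exact h3
    · exact Submodule.neg_mem _ h3
  have hg : ∀ j (x : G n), x ∈ Submodule.span ℝ (Set.range (blade (n := n))) →
      gen j * x ∈ Submodule.span ℝ (Set.range (blade (n := n))) := by
    intro j x hx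
    induction hx using Submodule.span_induction with
    | mem x hx =>
      obtain ⟨S, rfl⟩ := hx
      rw [blade, ← listProd_cons]
      exact hl _
    | zero => simp
    | add x y _ _ hx hy => rw [mul_add]; exact Submodule.add_mem _ hx hy
    | smul r x _ hx => rw [mul_smul_comm]; exact Submodule.smul_mem _ _ hx
  induction a using CliffordAlgebra.left_induction with
  | algebraMap r =>
    rw [Algebra.algebraMap_eq_smul_one]
    exact Submodule.smul_mem _ _ (hl [])
  | add x y hx hy => exact Submodule.add_mem _ hx hy
  | ι_mul x m hx =>
    have hm : m = ∑ j, m j • basisVec j := by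
      ext k
      rw [WithLp.ofLp_sum, Finset.sum_apply, Finset.sum_eq_single k]
      · simp [basisVec]
      · intro j _ hj
        simp [basisVec, hj.symm]
      · simp
    rw [hm, map_sum, Finset.sum_mul]
    refine Submodule.sum_mem _ fun j _ => ?_
    rw [map_smul, smul_mul_assoc]
    exact Submodule.smul_mem _ _ (hg j x hx)

lemma scalarPart_sum (c d : Finset (Fin n ⊕ Fin n) → ℝ) :
    scalarPart n ((∑ S, c S • blade S) * CliffordAlgebra.reverse (∑ S, d S • blade S)) =
      ∑ S, c S * d S := by
  simp only [map_sum, map_smul, Finset.sum_mul_sum, smul_mul_assoc, mul_smul_comm,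
    scalarPart_blade, smul_eq_mul]
  simp [mul_comm]

end Facts

/-- The scalar product `a · b = ⟨a b†⟩₀` of multivectors, where `†` is the reversion. -/
abbrev cliffordCore (n : ℕ) : InnerProductSpace.Core ℝ (G n) where
  inner a b := scalarPart n (a * CliffordAlgebra.reverse b)
  conj_inner_symm a b := by
    obtain ⟨c, rfl⟩ := exists_blade_sum a
    obtain ⟨d, rfl⟩ := exists_blade_sum b
    rw [scalarPart_sum, scalarPart_sum]
    simp [mul_comm]
  re_inner_nonneg a := by
    obtain ⟨c, rfl⟩ := exists_blade_sum a
    rw [scalarPart_sum]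
    exact (Finset.sum_nonneg fun S _ => mul_self_nonneg (c S) : (0 : ℝ) ≤ ∑ S, c S * c S)
  add_left a b c := by rw [add_mul, map_add]
  smul_left a b r := by rw [smul_mul_assoc, map_smul]; rfl
  definite a h := by
    obtain ⟨c, rfl⟩ := exists_blade_sum a
    rw [scalarPart_sum, Finset.sum_eq_zero_iff_of_nonneg fun S _ => mul_self_nonneg (c S)] at h
    refine Finset.sum_eq_zero fun S hS => ?_
    rw [mul_self_eq_zero.1 (h S hS), zero_smul]

/-- The norm `|a| = (a · a) ^ (1/2)` on the Clifford algebra. -/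
instance instNormedAddCommGroupG (n : ℕ) : NormedAddCommGroup (G n) :=
  @InnerProductSpace.Core.toNormedAddCommGroup ℝ (G n) _ _ _ (cliffordCore n)

instance instInnerProductSpaceG (n : ℕ) : InnerProductSpace ℝ (G n) :=
  InnerProductSpace.ofCore (cliffordCore n).toCore

lemma inner_eq {n : ℕ} (a b : G n) :
    inner ℝ a b = scalarPart n (a * CliffordAlgebra.reverse b) := rfl

/-- The norm is the Euclidean norm of the coefficients with respect to the basis `e_S`. -/
lemma norm_sq_eq {n : ℕ} (c : Finset (Fin n ⊕ Fin n) → ℝ) :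
    ‖∑ S, c S • (blade S : G n)‖ ^ 2 = ∑ S, c S ^ 2 := by
  rw [← real_inner_self_eq_norm_sq, inner_eq, scalarPart_sum]
  simp [sq]

instance instFiniteG (n : ℕ) : Module.Finite ℝ (G n) := by
  refine Module.Finite.of_surjective
    (Fintype.linearCombination ℝ (blade (n := n))) fun a => ?_
  obtain ⟨c, rfl⟩ := exists_blade_sum a
  exact ⟨c, by simp [Fintype.linearCombination_apply]⟩

instance instIsTopologicalRingG (n : ℕ) : IsTopologicalRing (G n) where
  continuous_mul := by
    let m : G n →ₗ[ℝ] G n →L[ℝ] G n :=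
      LinearMap.toContinuousLinearMap.toLinearMap ∘ₗ LinearMap.mul ℝ (G n)
    have hm : Continuous m := LinearMap.continuous_of_finiteDimensional m
    exact (hm.comp continuous_fst).clm_apply continuous_snd

/-! ### Monogenic functions -/

/-- The bivector `B_i = e_i e'_i`. -/
def biv {n : ℕ} (i : Fin n) : G n := e i * e' i

/-- The vector derivative of `f` in the plane spanned by `e_i, e'_i`, namely
`e_i ∂f/∂x_i + e'_i ∂f/∂x'_i`. -/
def vectorDeriv {n : ℕ} (i : Fin n) (f : R2n n → G n) (x : R2n n) : G n :=
  e i * fderiv ℝ f x (basisVec (Sum.inl i)) + e' i * fderiv ℝ f x (basisVec (Sum.inr i))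

/-- `f` is of class `C¹` on all of `ℝ²ⁿ` and (left-)monogenic there with respect to `B_i`. -/
def IsMonogenic {n : ℕ} (i : Fin n) (f : R2n n → G n) : Prop :=
  ContDiff ℝ 1 f ∧ ∀ x, vectorDeriv i f x = 0

/-! ### The Clifford–Fourier transform and its extension to `ℝ²ⁿ` -/

/-- The point `y + y' = ∑ y_i e_i + ∑ y'_i e'_i` of `ℝ²ⁿ`. -/
def pt {n : ℕ} (y y' : Rn n) : R2n n := WithLp.toLp 2 (Sum.elim y y')

/-- The projection `P_i` of `ℝ²ⁿ` onto the plane spanned by `e_i, e'_i`. -/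
def proj {n : ℕ} (i : Fin n) (x : R2n n) : G n :=
  x (Sum.inl i) • e i + x (Sum.inr i) • e' i

/-- The function `I(x, ŷ) = ∑ B_i P_i(x) P_i(ŷ)`. -/
def bilinI {n : ℕ} (x y : R2n n) : G n := ∑ i, biv i * proj i x * proj i y

/-- The extended kernel `e^{-I(x, ŷ)}`, for `x ∈ ℝⁿ ⊆ ℝ²ⁿ` and `ŷ ∈ ℝ²ⁿ`. -/
def kernel {n : ℕ} (x : Rn n) (y : R2n n) : G n := NormedSpace.exp (-bilinI (pt x 0) y)

/-- The normalized Lebesgue measure `dm(x) = (2π)^{-n/2} dx` on `ℝⁿ`. -/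
def normMeasure (n : ℕ) : Measure (Rn n) :=
  ENNReal.ofReal ((2 * Real.pi) ^ (-(n : ℝ) / 2)) • volume

/-- The integral that defines the extended transform of `F` converges at `ŷ`. -/
def TransformExists {n : ℕ} (F : Rn n → G n) (y : R2n n) : Prop :=
  Integrable (fun x => kernel x y * F x) (normMeasure n)

/-- The extension `ŷ ↦ ∫ e^{-I(x, ŷ)} F(x) dm(x)` to `ℝ²ⁿ` of the left Clifford–Fourier transform
of `F`. -/
def extTransform {n : ℕ} (F : Rn n → G n) (y : R2n n) : G n :=
  ∫ x, kernel x y * F x ∂(normMeasure n)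

/-- `F` vanishes (almost everywhere) outside the ball of radius `A` centred at `0`. -/
def VanishesOutsideBall {n : ℕ} (F : Rn n → G n) (A : ℝ) : Prop :=
  ∀ᵐ x ∂(normMeasure n), x ∉ Metric.closedBall (0 : Rn n) A → F x = 0

/-- The slice `f_{y'}(y) = f(y + y')`. -/
def slice {n : ℕ} (f : R2n n → G n) (y' : Rn n) (y : Rn n) : G n := f (pt y y')

/-- The growth bound `|f(ŷ)| ≤ C e^{A|ŷ|}` on `ℝ²ⁿ`. -/
def ExpBound {n : ℕ} (f : R2n n → G n) (A C : ℝ) : Prop :=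
  ∀ y, ‖f y‖ ≤ C * Real.exp (A * ‖y‖)

end CliffordFourier

end

namespace PaleyWiener

open Filter Topology FourierTransform Complex
open scoped RealInnerProductSpace

/-! Left multiplications by the bivectors B_i commute, square to -1 and are isometric, so they can
be diagonalized simultaneously with eigenvalues ±i (`exists_spectralFamily`). This gives complex
coordinates u_j of a multivector, with signs s_i depending on j, which satisfy Parseval's identity.
Since B_i e_i e_i = B_i and B_i e_i e'_i = -1, the kernel acts on the j-th coordinate as the scalar
exp(Σ x_i (y'_i - i s_i y_i)) (`coord_kernel_mul`). Multiplied by e_i, the monogenic equation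
becomes the Cauchy–Riemann equation in y'_i - i s_i y_i (`monogenic_iff_coord`). Both parts thus
reduce to scalar Paley–Wiener theory.

For the direct part, differentiation under the integral gives monogenicity. The exponential is at
most e^{A|y'|} on the ball, which gives the growth bound and, with Plancherel in each coordinate,
the L² bound.

For the converse, translation in y' turns a square integrable slice into the slice at 0.
Phragmén–Lindelöf then bounds the L² norm of every slice at ω by e^{A|ω|} times that at 0
(`eLpNorm_le_of_expGrowth`). Shifting the contour, after Gaussian regularization, shows that the
inverse Fourier transforms of the slices differ by the factor e^{2π x·ω} (`coeFn_fourierInv_slice`).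
Hence the weighted norms of one function G grow no faster than e^{A|ω|}, and letting ω tend to
infinity in each direction confines G to a ball (`ae_eq_zero_of_eLpNorm_expKernel_le`). Fourier
inversion recovers the slice at 0, and the identity theorem all the others. -/

theorem eLpNorm_two_sq {α E : Type*} [MeasurableSpace α] [NormedAddCommGroup E] {μ : Measure α}
    (f : α → E) : eLpNorm f 2 μ ^ 2 = ∫⁻ x, ‖f x‖ₑ ^ 2 ∂μ := by
  have h := eLpNorm_nnreal_pow_eq_lintegral (f := f) (μ := μ) (p := 2) two_ne_zero
  simpa only [NNReal.coe_ofNat, ENNReal.coe_ofNat, ENNReal.rpow_ofNat] using h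

/-! ### The Fourier transform on L¹ ∩ L² and Plancherel's identity -/

section Fourier

variable {V : Type*} [NormedAddCommGroup V] [InnerProductSpace ℝ V] [FiniteDimensional ℝ V]
  [MeasurableSpace V] [BorelSpace V]

theorem integral_mul_fourier {f g : V → ℂ} (hf : Integrable f) (hg : Integrable g) :
    ∫ x, 𝓕 g x * f x = ∫ x, g x * 𝓕 f x := by
  simpa using! VectorFourier.integral_fourierIntegral_smul_eq_flip (L := innerₗ V)
      Real.continuous_fourierChar continuous_inner hg hf

theorem integral_mul_fourierInv {f g : V → ℂ} (hf : Integrable f) (hg : Integrable g) :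
    ∫ x, 𝓕⁻ g x * f x = ∫ x, g x * 𝓕⁻ f x := by
  have h := integral_mul_fourier hf hg.comp_neg
  have e1 : ∀ x, 𝓕 (fun x => g (-x)) x = 𝓕⁻ g x := fun x =>
    (congrFun (Real.fourierInv_eq_fourier_comp_neg g) x).symm
  simp only [e1] at h
  rw [h, ← integral_neg_eq_self]
  simp [Real.fourierInv_eq_fourier_neg]

theorem continuous_fourier {f : V → ℂ} (hf : Integrable f) : Continuous (𝓕 f) :=
  VectorFourier.fourierIntegral_continuous Real.continuous_fourierChar
    (by exact continuous_inner) hf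

theorem continuous_fourierInv {f : V → ℂ} (hf : Integrable f) : Continuous (𝓕⁻ f) := by
  have : 𝓕⁻ f = fun x => 𝓕 f (-x) := by
    ext x; exact Real.fourierInv_eq_fourier_neg f x
  rw [this]
  exact (continuous_fourier hf).comp continuous_neg

/-- On `L¹ ∩ L²` the Fourier transform on `L²` is given by the Fourier integral. -/
theorem coeFn_fourier_toLp {f : V → ℂ} (h1 : Integrable f) (h2 : MemLp f 2) :
    (𝓕 (h2.toLp f) : Lp ℂ 2 (volume : Measure V)) =ᵐ[volume] 𝓕 f := by
  -- Test against smooth compactly supported functions: the L² transform is the distributional one,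
  -- which falls on the test function by duality, and the Fourier integral does the same by the
  -- multiplication formula.
  refine ae_eq_of_integral_contDiff_smul_eq ?_ (continuous_fourier h1).locallyIntegrable ?_
  · exact (Lp.memLp _).locallyIntegrable (by norm_num)
  intro g hg hgs
  have hs : HasCompactSupport (fun x => (g x : ℂ)) := hgs.comp_left (g := ((↑) : ℝ → ℂ)) rfl
  let ψ : SchwartzMap V ℂ := hs.toSchwartzMap (ofRealCLM.contDiff.comp hg)
  have key := congrArg (fun T => T ψ) (Lp.fourier_toTemperedDistribution_eq (h2.toLp f))
  simp only [TemperedDistribution.fourier_apply, Lp.toTemperedDistribution_apply] at key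
  have e1 : ∫ x, (𝓕 ψ) x • (h2.toLp f : Lp ℂ 2 (volume : Measure V)) x =
      ∫ x, 𝓕 (ψ : V → ℂ) x * f x := by
    refine integral_congr_ae ?_
    filter_upwards [h2.coeFn_toLp] with x hx
    rw [hx, SchwartzMap.fourier_coe, smul_eq_mul]
  rw [e1, integral_mul_fourier h1 ψ.integrable] at key
  have hψ : ∀ x, ψ x = (g x : ℂ) := fun _ => rfl
  simpa only [hψ, real_smul, smul_eq_mul] using key.symm

/-- On `L¹ ∩ L²` the inverse Fourier transform on `L²` is given by the inverse Fourier integral. -/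
theorem coeFn_fourierInv_toLp {f : V → ℂ} (h1 : Integrable f) (h2 : MemLp f 2) :
    (𝓕⁻ (h2.toLp f) : Lp ℂ 2 (volume : Measure V)) =ᵐ[volume] 𝓕⁻ f := by
  refine ae_eq_of_integral_contDiff_smul_eq ?_ (continuous_fourierInv h1).locallyIntegrable ?_
  · exact (Lp.memLp _).locallyIntegrable (by norm_num)
  intro g hg hgs
  have hs : HasCompactSupport (fun x => (g x : ℂ)) := hgs.comp_left (g := ((↑) : ℝ → ℂ)) rfl
  let ψ : SchwartzMap V ℂ := hs.toSchwartzMap (ofRealCLM.contDiff.comp hg)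
  have key := congrArg (fun T => T ψ) (Lp.fourierInv_toTemperedDistribution_eq (h2.toLp f))
  simp only [TemperedDistribution.fourierInv_apply, Lp.toTemperedDistribution_apply] at key
  have e1 : ∫ x, (𝓕⁻ ψ) x • (h2.toLp f : Lp ℂ 2 (volume : Measure V)) x =
      ∫ x, 𝓕⁻ (ψ : V → ℂ) x * f x := by
    refine integral_congr_ae ?_
    filter_upwards [h2.coeFn_toLp] with x hx
    rw [hx, SchwartzMap.fourierInv_coe, smul_eq_mul]
  rw [e1, integral_mul_fourierInv h1 ψ.integrable] at key
  have hψ : ∀ x, ψ x = (g x : ℂ) := fun _ => rfl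
  simpa only [hψ, real_smul, smul_eq_mul] using key.symm

theorem lintegral_enorm_sq_fourier {f : V → ℂ} (h1 : Integrable f) (h2 : MemLp f 2) :
    ∫⁻ x, ‖𝓕 f x‖ₑ ^ 2 = ∫⁻ x, ‖f x‖ₑ ^ 2 := by
  have hn : ‖(𝓕 (h2.toLp f) : Lp ℂ 2 (volume : Measure V))‖ₑ = ‖h2.toLp f‖ₑ := by
    rw [← ofReal_norm, ← ofReal_norm, Lp.norm_fourier_eq]
  rw [Lp.enorm_toLp, Lp.enorm_def, eLpNorm_congr_ae (coeFn_fourier_toLp h1 h2)] at hn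
  rw [← eLpNorm_two_sq, ← eLpNorm_two_sq, hn]

end Fourier

/-! ### Holomorphic dependence on a parameter -/

section Holomorphic

variable {α : Type*} [MeasurableSpace α] {μ : Measure α}

/-- The integral of a locally dominated family of entire functions is entire. -/
theorem differentiable_integral_of_dominated {F : ℂ → α → ℂ}
    (hd : ∀ a, Differentiable ℂ fun w => F w a) (hm : ∀ w, AEStronglyMeasurable (F w) μ)
    (hb : ∀ R : ℝ, ∃ b : α → ℝ, Integrable b μ ∧ ∀ᵐ a ∂μ, ∀ w, ‖w‖ ≤ R → ‖F w a‖ ≤ b a) :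
    Differentiable ℂ fun w => ∫ a, F w a ∂μ := by
  intro w₀
  -- The radius leaves room for unit circles around points of the unit ball about `w₀`; Cauchy's
  -- estimate on them makes `b` dominate the derivative too.
  obtain ⟨b, hbi, hb⟩ := hb (‖w₀‖ + 2)
  -- Difference quotients along this sequence show that the derivative at `w₀` is measurable in `a`.
  have hlim : Tendsto (fun k : ℕ => w₀ + ((1 / ((k : ℝ) + 1) : ℝ) : ℂ)) atTop (𝓝[≠] w₀) := by
    refine tendsto_nhdsWithin_iff.2 ⟨?_, Eventually.of_forall fun k => ?_⟩
    · have := (continuous_ofReal.tendsto 0).comp (tendsto_one_div_add_atTop_nhds_zero_nat (𝕜 := ℝ))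
      simpa using this.const_add w₀
    · simp only [Set.mem_compl_iff, Set.mem_singleton_iff, add_eq_left, ofReal_eq_zero]
      positivity
  have hm' : AEStronglyMeasurable (fun a => deriv (fun w => F w a) w₀) μ := by
    refine aestronglyMeasurable_of_tendsto_ae atTop
      (f := fun (k : ℕ) a => slope (fun w => F w a) w₀ (w₀ + ((1 / ((k : ℝ) + 1) : ℝ) : ℂ)))
      (fun k => ?_) (Eventually.of_forall fun a => ?_)
    · simp only [slope_def_field, div_eq_mul_inv]
      exact ((hm _).sub (hm _)).mul_const _
    · exact (hasDerivAt_iff_tendsto_slope.1 (hd a w₀).hasDerivAt).comp hlim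
  refine (hasDerivAt_integral_of_dominated_loc_of_deriv_le
    (F' := fun w a => deriv (fun w => F w a) w) (bound := b)
    (Metric.ball_mem_nhds w₀ one_pos) (Eventually.of_forall hm) ?_ hm' ?_ hbi
    (Eventually.of_forall fun a w _ => (hd a w).hasDerivAt)).2.differentiableAt
  · refine hbi.mono' (hm w₀) (hb.mono fun a ha => ha w₀ (by linarith))
  · filter_upwards [hb] with a ha w hw
    have := norm_deriv_le_of_forall_mem_sphere_norm_le (c := w) (C := b a) one_pos
      (hd a).diffContOnCl (fun z hz => ha z ?_)
    · simpa using this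
    · rw [mem_sphere_iff_norm] at hz
      rw [mem_ball_iff_norm] at hw
      linarith [norm_sub_norm_le z w, norm_sub_norm_le w w₀]

end Holomorphic

end PaleyWiener

namespace PaleyWiener

open Filter Topology FourierTransform Complex
open scoped RealInnerProductSpace

theorem enorm_integral_mul_le {α : Type*} [MeasurableSpace α] {μ : Measure α} {f g : α → ℂ}
    (hf : AEStronglyMeasurable f μ) (hg : AEStronglyMeasurable g μ) :
    ‖∫ x, f x * g x ∂μ‖ₑ ≤ eLpNorm f 2 μ * eLpNorm g 2 μ := by
  refine (enorm_integral_le_lintegral_enorm _).trans ?_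
  rw [← eLpNorm_one_eq_lintegral_enorm]
  have h := eLpNorm_smul_le_mul_eLpNorm (p := 2) (q := 2) (r := 1) hg hf
  exact h

/-! ### The Plancherel–Pólya inequality -/

section Growth

variable {V : Type*} [NormedAddCommGroup V]

/-- Growth of exponential type. -/
def ExpGrowth (g : V → V → ℂ) (A C : ℝ) : Prop :=
  ∀ y y', ‖g y y'‖ ≤ C * Real.exp (A * (‖y‖ + ‖y'‖))

theorem ExpGrowth.nonneg {g : V → V → ℂ} {A C : ℝ} (h : ExpGrowth g A C) : 0 ≤ C := by
  have := (norm_nonneg _).trans (h 0 0)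
  simpa using this

variable [InnerProductSpace ℝ V]

/-- The function `g` of `y` and `y'` is entire along each complex line in the variable
`y' - i y` whose direction is real. -/
def EntireOnLines (g : V → V → ℂ) : Prop :=
  ∀ y y' ω : V, Differentiable ℂ fun w : ℂ => g (y - w.im • ω) (y' + w.re • ω)

variable [FiniteDimensional ℝ V] [MeasurableSpace V] [BorelSpace V]

/-- Phragmén–Lindelöf in the right half-plane, applied to e^{-A|ω|w} H(w) with H(w) = ∫ g(y - Im w
ω, Re w ω) θ(y) dy. On the imaginary axis g enters through translates of its slice at 0, so Hölder's
inequality applies; on the positive reals the growth of g gives boundedness. The claim is the value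
at w = 1. -/
theorem enorm_integral_mul_le_of_expGrowth {g : V → V → ℂ} {A C : ℝ} (hA : 0 ≤ A)
    (hc : Continuous fun p : V × V => g p.1 p.2) (hg : EntireOnLines g) (hgr : ExpGrowth g A C)
    (h2 : MemLp (g · 0) 2) {θ : V → ℂ} (hθ : Continuous θ) (hθs : HasCompactSupport θ) (ω : V) :
    ‖∫ y, g y ω * θ y‖ₑ ≤
      ENNReal.ofReal (Real.exp (A * ‖ω‖)) * (eLpNorm (g · 0) 2 volume * eLpNorm θ 2 volume) := by
  set F : ℂ → V → ℂ := fun w y => g (y - w.im • ω) (w.re • ω) * θ y with hF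
  have hFc : ∀ w, Continuous (F w) := fun w => by
    have : Continuous fun y : V => g (y - w.im • ω) (w.re • ω) :=
      hc.comp (f := fun y : V => (y - w.im • ω, w.re • ω)) (by fun_prop)
    exact this.mul hθ
  set b : V → ℝ := fun y => C * Real.exp (A * ‖y‖) * ‖θ y‖ with hb
  have hbi : Integrable b := by
    refine Continuous.integrable_of_hasCompactSupport (by fun_prop) ?_
    exact hθs.norm.mul_left
  have hFb : ∀ w y, ‖F w y‖ ≤ Real.exp (A * ‖ω‖ * (|w.im| + |w.re|)) * b y := fun w y => by
    rw [hF, hb, norm_mul, ← mul_assoc]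
    refine mul_le_mul_of_nonneg_right ((hgr _ _).trans ?_) (norm_nonneg _)
    rw [mul_left_comm, ← Real.exp_add]
    refine mul_le_mul_of_nonneg_left (Real.exp_le_exp.2 ?_) hgr.nonneg
    have h1 := norm_sub_le y (w.im • ω)
    rw [norm_smul, Real.norm_eq_abs] at h1
    rw [norm_smul, Real.norm_eq_abs]
    nlinarith
  have hFi : ∀ w, Integrable (F w) := fun w =>
    (hbi.const_mul _).mono' (hFc w).aestronglyMeasurable (Eventually.of_forall (hFb w))
  set H : ℂ → ℂ := fun w => ∫ y, F w y with hH
  have hHd : Differentiable ℂ H := by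
    refine differentiable_integral_of_dominated (fun y => ?_)
      (fun w => (hFc w).aestronglyMeasurable) fun R => ?_
    · have := hg y 0 ω
      simp only [zero_add] at this
      exact this.mul_const _
    · refine ⟨fun y => Real.exp (A * ‖ω‖ * (R + R)) * b y, hbi.const_mul _,
        Eventually.of_forall fun y w hw => (hFb w y).trans ?_⟩
      have hby : 0 ≤ b y := by have := hgr.nonneg; positivity
      have h1 := (abs_im_le_norm w).trans hw
      have h2 := (abs_re_le_norm w).trans hw
      refine mul_le_mul_of_nonneg_right (Real.exp_le_exp.2 ?_) hby
      exact mul_le_mul_of_nonneg_left (add_le_add h1 h2) (by positivity)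
  have hHb : ∀ w, ‖H w‖ ≤ Real.exp (A * ‖ω‖ * (|w.im| + |w.re|)) * ∫ y, b y := fun w => by
    rw [← integral_const_mul]
    exact norm_integral_le_of_norm_le (hbi.const_mul _) (Eventually.of_forall (hFb w))
  have hb0 : 0 ≤ ∫ y, b y := integral_nonneg fun y => by have := hgr.nonneg; positivity
  set M : ℝ≥0∞ := eLpNorm (g · 0) 2 volume * eLpNorm θ 2 volume with hM
  have hMt : M ≠ ∞ := ENNReal.mul_ne_top h2.eLpNorm_ne_top
    (hθ.memLp_of_hasCompactSupport hθs).eLpNorm_ne_top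
  have him : ∀ v : ℝ, ‖H (v * I)‖ ≤ M.toReal := fun v => by
    rw [← toReal_enorm]
    refine ENNReal.toReal_mono hMt ?_
    simp only [hH, hF, mul_im, ofReal_re, I_im, mul_one, ofReal_im, I_re, mul_zero, add_zero,
      mul_re, sub_self, zero_smul]
    have hcm : Continuous fun y : V => g (y - v • ω) 0 :=
      hc.comp (f := fun y : V => (y - v • ω, (0 : V))) (by fun_prop)
    refine (enorm_integral_mul_le hcm.aestronglyMeasurable hθ.aestronglyMeasurable).trans_eq ?_
    rw [hM]
    congr 1
    exact eLpNorm_comp_measurePreserving (g := (g · 0)) h2.aestronglyMeasurable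
      (measurePreserving_sub_right volume (v • ω))
  have hPL : ‖H 1 * cexp (-((A * ‖ω‖ : ℝ) : ℂ) * 1)‖ ≤ M.toReal := by
    refine PhragmenLindelof.right_half_plane_of_bounded_on_real
      (f := fun w => H w * cexp (-((A * ‖ω‖ : ℝ) : ℂ) * w)) ?_ ?_ ?_ ?_ (z := 1) (by simp)
    · refine Differentiable.diffContOnCl ?_
      fun_prop
    -- Two of the three units come from |Im w| + |Re w| ≤ 2|w|, the third from the damping factor.
    · refine ⟨1, by norm_num, 3 * (A * ‖ω‖), Asymptotics.IsBigO.of_bound (∫ y, b y) ?_⟩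
      refine Eventually.of_forall fun w => ?_
      rw [norm_mul, norm_exp, Real.rpow_one, Real.norm_eq_abs, Real.abs_exp]
      refine (mul_le_mul_of_nonneg_right (hHb w) (Real.exp_nonneg _)).trans ?_
      rw [mul_right_comm, ← Real.exp_add, mul_comm]
      refine mul_le_mul_of_nonneg_left (Real.exp_le_exp.2 ?_) hb0
      have h1 := abs_im_le_norm w
      have h2 := abs_re_le_norm w
      have h3 := neg_abs_le w.re
      have h4 : 0 ≤ A * ‖ω‖ := by positivity
      rw [← ofReal_neg, re_ofReal_mul]
      nlinarith
    · refine isBoundedUnder_of_eventually_le (a := ∫ y, b y) ?_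
      filter_upwards [eventually_ge_atTop 0] with t ht
      rw [norm_mul, norm_exp]
      refine (mul_le_mul_of_nonneg_right (hHb t) (Real.exp_nonneg _)).trans ?_
      rw [mul_right_comm, ← Real.exp_add, ← ofReal_neg, re_ofReal_mul]
      simp [abs_of_nonneg ht]
    · intro v
      rw [norm_mul, norm_exp, ← ofReal_neg, re_ofReal_mul]
      simpa using him v
  have hH1 : H 1 = ∫ y, g y ω * θ y := by simp [hH, hF]
  rw [hH1, norm_mul, norm_exp, mul_one, neg_re, ofReal_re, Real.exp_neg, ← div_eq_mul_inv,
    div_le_iff₀ (Real.exp_pos _)] at hPL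
  rw [← ofReal_norm, mul_comm, ← ENNReal.ofReal_toReal hMt, ← ENNReal.ofReal_mul (by positivity)]
  exact ENNReal.ofReal_le_ofReal hPL

/-- The `L²` version of the theorem of Plancherel and Pólya. -/
theorem eLpNorm_le_of_expGrowth {g : V → V → ℂ} {A C : ℝ} (hA : 0 ≤ A)
    (hc : Continuous fun p : V × V => g p.1 p.2) (hg : EntireOnLines g) (hgr : ExpGrowth g A C)
    (h2 : MemLp (g · 0) 2) (ω : V) :
    eLpNorm (g · ω) 2 volume ≤
      ENNReal.ofReal (Real.exp (A * ‖ω‖)) * eLpNorm (g · 0) 2 volume := by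
  have hcω : Continuous (g · ω) := hc.comp (f := fun y : V => (y, ω)) (by fun_prop)
  set K := ENNReal.ofReal (Real.exp (A * ‖ω‖)) * eLpNorm (g · 0) 2 volume with hK
  -- The slice at `ω` is not yet known to be square integrable. After a cutoff its norm `N` is
  -- finite, so `N` can be cancelled from N² ≤ K N; Fatou's lemma then removes the cutoff.
  have hcut : ∀ k : ℕ, ∃ χ : V → ℝ, Continuous χ ∧ Set.EqOn χ 1 (Metric.closedBall (0 : V) k) ∧
      eLpNorm (fun y => g y ω * χ y) 2 volume ≤ K := by
    intro k
    obtain ⟨χ, hχ1, -, hχs, hχI⟩ := exists_continuous_one_zero_of_isCompact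
      (isCompact_closedBall (0 : V) k) isClosed_empty (Set.disjoint_empty _)
    refine ⟨χ, χ.continuous, hχ1, ?_⟩
    have hχc : Continuous χ := χ.continuous
    have hχs' : HasCompactSupport fun y => (χ y : ℂ) := hχs.comp_left (g := ((↑) : ℝ → ℂ)) rfl
    have hu : Continuous fun y => g y ω * χ y := by fun_prop
    have hus : HasCompactSupport fun y => g y ω * χ y := hχs'.mul_left
    have hum : MemLp (fun y => g y ω * χ y) 2 := hu.memLp_of_hasCompactSupport hus
    set N := eLpNorm (fun y => g y ω * χ y) 2 volume with hN
    have h := enorm_integral_mul_le_of_expGrowth hA hc hg hgr h2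
      -- The second factor `χ y` turns the pairing with g into the full squared norm of the
      -- truncated slice.
      (θ := fun y => (starRingEnd ℂ) (g y ω * χ y) * χ y) (by fun_prop) hχs'.mul_left ω
    have hle : eLpNorm (fun y => (starRingEnd ℂ) (g y ω * χ y) * χ y) 2 volume ≤ N := by
      refine eLpNorm_mono fun y => ?_
      rw [norm_mul, RCLike.norm_conj, norm_real, Real.norm_of_nonneg (hχI y).1]
      exact mul_le_of_le_one_right (norm_nonneg _) (hχI y).2
    have hsq : ‖∫ y, g y ω * ((starRingEnd ℂ) (g y ω * χ y) * χ y)‖ₑ = N ^ 2 := by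
      have e1 : ∀ y, g y ω * ((starRingEnd ℂ) (g y ω * χ y) * χ y) =
          ((‖g y ω * χ y‖ ^ 2 : ℝ) : ℂ) := fun y => by
        rw [ofReal_pow, ← mul_conj']; ring
      simp only [e1]
      rw [integral_complex_ofReal, ← ofReal_norm, norm_real,
        Real.norm_of_nonneg (integral_nonneg fun y => by positivity),
        ofReal_integral_eq_lintegral_ofReal (MemLp.integrable_norm_pow (p := 2) hum two_ne_zero)
          (Eventually.of_forall fun y => by positivity), hN, eLpNorm_two_sq]
      simp only [ENNReal.ofReal_pow (norm_nonneg _), ofReal_norm]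
    rw [hsq, ← mul_assoc, ← hK] at h
    have h' : N * N ≤ K * N := by
      rw [← sq]; exact h.trans (mul_le_mul_right hle K)
    by_cases hN0 : N = 0
    · rw [hN0]; exact zero_le
    · exact (ENNReal.mul_le_mul_iff_left hN0 hum.eLpNorm_ne_top).1 h'
  choose χ hχc hχ1 hχK using hcut
  refine (Lp.eLpNorm_lim_le_liminf_eLpNorm (f := fun k y => g y ω * χ k y) (fun k => ?_) _
    (Eventually.of_forall fun y => ?_)).trans ?_
  · have := hχc k
    exact Continuous.aestronglyMeasurable (by fun_prop)
  · refine tendsto_const_nhds.congr' ?_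
    filter_upwards [eventually_ge_atTop ⌈‖y‖⌉₊] with k hk
    rw [hχ1 k (by simpa using Nat.ceil_le.1 hk)]
    simp
  · exact liminf_le_of_le (by isBoundedDefault) fun b hb => hb.exists.elim fun k hk => hk.trans (hχK k)

end Growth

end PaleyWiener

namespace PaleyWiener

open Filter Topology FourierTransform Complex
open scoped RealInnerProductSpace

/-! ### Gaussian regularization and contour shift -/

section ContourShift

variable {V : Type*} [NormedAddCommGroup V] [InnerProductSpace ℝ V]

theorem EntireOnLines.mul {g k : V → V → ℂ} (hg : EntireOnLines g) (hk : EntireOnLines k) :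
    EntireOnLines fun y y' => g y y' * k y y' :=
  fun y y' ω => (hg y y' ω).mul (hk y y' ω)

/-- The kernel `e^{2π x · z}` with `z = y' - i y`. -/
noncomputable def expKernel (x y y' : V) : ℂ := cexp (2 * Real.pi * (⟪x, y'⟫ - I * ⟪x, y⟫))

theorem norm_expKernel (x y y' : V) : ‖expKernel x y y'‖ = Real.exp (2 * Real.pi * ⟪x, y'⟫) := by
  rw [expKernel, norm_exp]
  congr 1
  have : (2 * (Real.pi : ℂ)) = ((2 * Real.pi : ℝ) : ℂ) := by push_cast; rfl
  rw [this, re_ofReal_mul]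
  simp

theorem expKernel_add (x y y' v v' : V) :
    expKernel x (y + v) (y' + v') = expKernel x y y' * expKernel x v v' := by
  rw [expKernel, expKernel, expKernel, ← Complex.exp_add]
  congr 1
  simp only [inner_add_right]
  push_cast
  ring

theorem continuous_expKernel :
    Continuous fun p : V × V × V => expKernel p.1 p.2.1 p.2.2 := by
  unfold expKernel
  fun_prop

theorem entireOnLines_expKernel (x : V) : EntireOnLines (expKernel x) := by
  intro y y' ω
  have h : (fun w : ℂ => expKernel x (y - w.im • ω) (y' + w.re • ω)) = fun w : ℂ =>
      cexp (2 * Real.pi * (⟪x, y'⟫ - I * ⟪x, y⟫) + w * (2 * Real.pi * ⟪x, ω⟫)) := by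
    ext w
    rw [expKernel]
    congr 1
    simp only [inner_add_right, inner_sub_right, real_inner_smul_right]
    push_cast
    conv_rhs => rw [← re_add_im w]
    ring
  rw [h]
  fun_prop

/-- The Gaussian `e^{ε z · z}` with `z = y' - i y`. -/
noncomputable def gauss (ε : ℝ) (y y' : V) : ℂ := cexp (ε * (⟪y', y'⟫ - ⟪y, y⟫ - 2 * I * ⟪y, y'⟫))

theorem norm_gauss (ε : ℝ) (y y' : V) :
    ‖gauss ε y y'‖ = Real.exp (ε * (‖y'‖ ^ 2 - ‖y‖ ^ 2)) := by
  rw [gauss, norm_exp, re_ofReal_mul]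
  simp [-ofReal_pow]

theorem continuous_gauss (ε : ℝ) : Continuous fun p : V × V => gauss ε p.1 p.2 := by
  unfold gauss
  fun_prop

theorem entireOnLines_gauss (ε : ℝ) : EntireOnLines (gauss (V := V) ε) := by
  intro y y' ω
  have h : (fun w : ℂ => gauss ε (y - w.im • ω) (y' + w.re • ω)) = fun w : ℂ =>
      cexp (ε * (⟪y', y'⟫ - ⟪y, y⟫ - 2 * I * ⟪y, y'⟫
        + 2 * w * (⟪y', ω⟫ - I * ⟪y, ω⟫) + w ^ 2 * ⟪ω, ω⟫)) := by
    ext w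
    rw [gauss]
    congr 1
    simp only [inner_add_right, inner_sub_right, inner_add_left, inner_sub_left,
      real_inner_smul_right, real_inner_smul_left, real_inner_comm ω]
    push_cast
    conv_rhs => rw [← re_add_im w]
    ring_nf
    simp only [I_sq]
    ring
  rw [h]
  fun_prop

variable {g : V → V → ℂ} {A C : ℝ}

/-- Both shifts have norm at most R|ω|, so |y - Im w ω|² ≥ |y|² - 2R|ω||y|. What remains is a
Gaussian against a linear exponent, uniformly for |w| ≤ R, which is the majorant needed to shift the
contour. -/
theorem ExpGrowth.norm_mul_gauss_le (hA : 0 ≤ A) (hgr : ExpGrowth g A C) {ε : ℝ} (hε : 0 < ε)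
    {y ω : V} {w : ℂ} {R : ℝ} (hw : ‖w‖ ≤ R) :
    ‖g (y - w.im • ω) (w.re • ω) * gauss ε (y - w.im • ω) (w.re • ω)‖ ≤
      C * Real.exp (2 * A * (R * ‖ω‖) + ε * (R * ‖ω‖) ^ 2) *
        Real.exp ((A + 2 * ε * (R * ‖ω‖)) * ‖y‖ - ε * ‖y‖ ^ 2) := by
  rw [norm_mul, norm_gauss, mul_assoc, ← Real.exp_add]
  refine (mul_le_mul_of_nonneg_right (hgr _ _) (Real.exp_nonneg _)).trans ?_
  rw [mul_assoc, ← Real.exp_add]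
  refine mul_le_mul_of_nonneg_left (Real.exp_le_exp.2 ?_) hgr.nonneg
  have hR : 0 ≤ R := (norm_nonneg w).trans hw
  have h1 : ‖w.im • ω‖ ≤ R * ‖ω‖ := by
    rw [norm_smul]
    exact mul_le_mul_of_nonneg_right ((abs_im_le_norm w).trans hw) (norm_nonneg _)
  have h2 : ‖w.re • ω‖ ≤ R * ‖ω‖ := by
    rw [norm_smul]
    exact mul_le_mul_of_nonneg_right ((abs_re_le_norm w).trans hw) (norm_nonneg _)
  have h3 := norm_sub_le y (w.im • ω)
  have h4 : ‖y‖ ^ 2 - 2 * (R * ‖ω‖) * ‖y‖ ≤ ‖y - w.im • ω‖ ^ 2 := by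
    rw [norm_sub_sq_real]
    have h5 := real_inner_le_norm y (w.im • ω)
    have h6 := mul_le_mul_of_nonneg_left h1 (norm_nonneg y)
    nlinarith [sq_nonneg ‖w.im • ω‖]
  have h7 : ‖w.re • ω‖ ^ 2 ≤ (R * ‖ω‖) ^ 2 := pow_le_pow_left₀ (norm_nonneg _) h2 2
  have h8 : A * (‖y - w.im • ω‖ + ‖w.re • ω‖) ≤ A * (‖y‖ + R * ‖ω‖ + R * ‖ω‖) :=
    mul_le_mul_of_nonneg_left (by linarith) hA
  have h9 : ε * (‖w.re • ω‖ ^ 2 - ‖y - w.im • ω‖ ^ 2) ≤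
      ε * ((R * ‖ω‖) ^ 2 - (‖y‖ ^ 2 - 2 * (R * ‖ω‖) * ‖y‖)) :=
    mul_le_mul_of_nonneg_left (by linarith) hε.le
  nlinarith

variable [FiniteDimensional ℝ V] [MeasurableSpace V] [BorelSpace V]

/-- Shift of the contour of integration. -/
theorem integral_eq_of_entireOnLines {k : V → V → ℂ}
    (hc : Continuous fun p : V × V => k p.1 p.2) (hk : EntireOnLines k) (ω : V)
    (hb : ∀ R : ℝ, ∃ b : V → ℝ, Integrable b ∧
      ∀ y, ∀ w : ℂ, ‖w‖ ≤ R → ‖k (y - w.im • ω) (w.re • ω)‖ ≤ b y) :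
    ∫ y, k y ω = ∫ y, k y 0 := by
  set H : ℂ → ℂ := fun w => ∫ y, k (y - w.im • ω) (w.re • ω) with hH
  have hHd : Differentiable ℂ H := by
    refine differentiable_integral_of_dominated (fun y => ?_) (fun w => ?_) fun R => ?_
    · have := hk y 0 ω
      simpa only [zero_add] using this
    · exact (hc.comp (f := fun y : V => (y - w.im • ω, w.re • ω))
        (by fun_prop)).aestronglyMeasurable
    · obtain ⟨b, hbi, hb⟩ := hb R
      exact ⟨b, hbi, Eventually.of_forall hb⟩
  -- By translation invariance the entire function `H` depends only on Re w. Its derivative along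
  -- the imaginary direction therefore vanishes, and `H` is constant.
  have hre : ∀ w, H w = ∫ y, k y (w.re • ω) := fun w =>
    integral_sub_right_eq_self (fun y => k y (w.re • ω)) (w.im • ω)
  have hder : ∀ w, deriv H w = 0 := fun w => by
    have h1 : HasDerivAt (fun v : ℝ => w + v * I) I 0 := by
      simpa using (((hasDerivAt_id (0 : ℝ)).ofReal_comp).mul_const I).const_add w
    have h2 : HasDerivAt (fun v : ℝ => H (w + v * I)) (deriv H w * I) 0 := by
      have h3 : HasDerivAt H (deriv H w) (w + ((0 : ℝ) : ℂ) * I) := by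
        simpa using (hHd w).hasDerivAt
      exact HasDerivAt.comp (𝕜 := ℝ) (𝕜' := ℂ) (0 : ℝ) h3 h1
    have h4 : (fun v : ℝ => H (w + v * I)) = fun _ => H w := by
      ext v
      rw [hre, hre]
      simp
    rw [h4] at h2
    simpa using h2.unique (hasDerivAt_const _ _)
  have := is_const_of_deriv_eq_zero hHd hder 1 0
  simpa [hre] using this

theorem integrable_exp_sub_sq {ε : ℝ} (hε : 0 < ε) (B : ℝ) :
    Integrable fun y : V => Real.exp (B * ‖y‖ - ε * ‖y‖ ^ 2) := by
  -- Half of the Gaussian absorbs the linear term; completing the square costs the constant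
  -- e^{B²/(2ε)}.
  have h := (GaussianFourier.integrable_cexp_neg_mul_sq_norm_add (V := V) (b := (ε / 2 : ℝ))
    (by simpa using hε) 0 0).norm.const_mul (Real.exp (B ^ 2 / (2 * ε)))
  refine h.mono' (by fun_prop) (Eventually.of_forall fun y => ?_)
  rw [norm_exp, ← Real.exp_add, Real.norm_eq_abs, Real.abs_exp]
  refine Real.exp_le_exp.2 ?_
  have e1 : (-((ε / 2 : ℝ) : ℂ) * (‖y‖ : ℂ) ^ 2 + 0 * (⟪(0 : V), y⟫ : ℝ)).re =
      -(ε / 2) * ‖y‖ ^ 2 := by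
    rw [zero_mul, add_zero, ← ofReal_neg, ← ofReal_pow, re_ofReal_mul, ofReal_re]
  rw [e1]
  have h1 : 0 ≤ (B - ε * ‖y‖) ^ 2 / (2 * ε) := by positivity
  have h2 : (B - ε * ‖y‖) ^ 2 / (2 * ε) = B ^ 2 / (2 * ε) - B * ‖y‖ + ε / 2 * ‖y‖ ^ 2 := by
    field_simp
    ring
  linarith

theorem ExpGrowth.integrable_mul_gauss (hA : 0 ≤ A)
    (hc : Continuous fun p : V × V => g p.1 p.2) (hgr : ExpGrowth g A C) {ε : ℝ} (hε : 0 < ε)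
    (ω : V) : Integrable fun y => g y ω * gauss ε y ω := by
  have hm : Continuous fun y : V => g y ω * gauss ε y ω :=
    (hc.mul (continuous_gauss ε)).comp (f := fun y : V => (y, ω)) (by fun_prop)
  refine ((integrable_exp_sub_sq hε (A + 2 * ε * (1 * ‖ω‖))).const_mul
    (C * Real.exp (2 * A * (1 * ‖ω‖) + ε * (1 * ‖ω‖) ^ 2))).mono'
      hm.aestronglyMeasurable (Eventually.of_forall fun y => ?_)
  have := hgr.norm_mul_gauss_le hA hε (y := y) (ω := ω) (w := 1) (R := 1) (by simp)
  simpa using this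

/-- At height y' the Fourier character is e^{2π x·y'} times `expKernel (-x) y y'`, which is entire
on lines. The first factor leaves the integral, and the rest does not depend on the height by the
contour shift. -/
theorem fourierInv_mul_gauss (hA : 0 ≤ A) (hc : Continuous fun p : V × V => g p.1 p.2)
    (hg : EntireOnLines g) (hgr : ExpGrowth g A C) {ε : ℝ} (hε : 0 < ε) (ω x : V) :
    𝓕⁻ (fun y => g y ω * gauss ε y ω) x =
      expKernel x 0 ω * 𝓕⁻ (fun y => g y 0 * gauss ε y 0) x := by
  have h := integral_eq_of_entireOnLines (k := fun y y' => g y y' * gauss ε y y' *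
    expKernel (-x) y y') ?_ ((hg.mul (entireOnLines_gauss ε)).mul (entireOnLines_expKernel _)) ω ?_
  · have e1 : ∀ y y' : V, Real.fourierChar ⟪y, x⟫ • (g y y' * gauss ε y y') =
        expKernel x 0 y' * (g y y' * gauss ε y y' * expKernel (-x) y y') := fun y y' => by
      have : expKernel x 0 y' * expKernel (-x) y y' = Real.fourierChar ⟪y, x⟫ := by
        rw [expKernel, expKernel, ← Complex.exp_add, Real.fourierChar_apply]
        congr 1
        simp only [inner_neg_left, inner_zero_right, real_inner_comm x y]
        push_cast
        ring
      rw [Circle.smul_def, ← this, smul_eq_mul]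
      ring
    have e2 : expKernel x 0 0 = 1 := by simp [expKernel]
    rw [Real.fourierInv_eq, Real.fourierInv_eq]
    simp only [e1, integral_const_mul, e2, one_mul]
    rw [h]
  · exact (hc.mul (continuous_gauss ε)).mul
      (continuous_expKernel.comp (f := fun p : V × V => (-x, p.1, p.2)) (by fun_prop))
  · intro R
    refine ⟨fun y => (C * Real.exp (2 * A * (R * ‖ω‖) + ε * (R * ‖ω‖) ^ 2) *
        Real.exp ((A + 2 * ε * (R * ‖ω‖)) * ‖y‖ - ε * ‖y‖ ^ 2)) *
        Real.exp (2 * Real.pi * (‖x‖ * (R * ‖ω‖))),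
      ((integrable_exp_sub_sq hε _).const_mul _).mul_const _, fun y w hw => ?_⟩
    rw [norm_mul, norm_expKernel]
    refine mul_le_mul (hgr.norm_mul_gauss_le hA hε hw) (Real.exp_le_exp.2 ?_)
      (Real.exp_nonneg _) (by have := hgr.nonneg; positivity)
    refine mul_le_mul_of_nonneg_left ((real_inner_le_norm _ _).trans ?_) (by positivity)
    rw [norm_neg, norm_smul]
    exact mul_le_mul_of_nonneg_left (mul_le_mul_of_nonneg_right
      ((abs_re_le_norm w).trans hw) (norm_nonneg _)) (norm_nonneg _)

end ContourShift

end PaleyWiener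

namespace PaleyWiener

open Filter Topology FourierTransform Complex
open scoped RealInnerProductSpace

/-! ### Limits and integrability in L² -/

section Lp

variable {α E : Type*} [MeasurableSpace α] {μ : Measure α} [NormedAddCommGroup E]

theorem tendsto_toLp_of_dominated {u : ℕ → α → E} {v : α → E} {c : ℝ} (hu : ∀ k, MemLp (u k) 2 μ)
    (hv : MemLp v 2 μ) (hb : ∀ k x, ‖u k x‖ ≤ c * ‖v x‖)
    (hlim : ∀ x, Tendsto (fun k => u k x) atTop (𝓝 (v x))) :
    Tendsto (fun k => (hu k).toLp (u k)) atTop (𝓝 (hv.toLp v)) := by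
  rw [Lp.tendsto_Lp_iff_tendsto_eLpNorm'' u hu v hv]
  have hw : MemLp (fun x => (c + 1) * ‖v x‖) 2 μ := hv.norm.const_mul _
  have h : Tendsto (fun k => eLpNorm (u k - v) 2 μ ^ 2) atTop (𝓝 0) := by
    simp only [eLpNorm_two_sq]
    have := tendsto_lintegral_of_dominated_convergence' (μ := μ)
      (F := fun k x => ‖(u k - v) x‖ₑ ^ 2) (f := fun _ => 0)
      (fun x => ‖(c + 1) * ‖v x‖‖ₑ ^ 2) (fun k => ((hu k).sub hv).1.enorm.pow_const 2)
      (fun k => Eventually.of_forall fun x => ?_) ?_ (Eventually.of_forall fun x => ?_)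
    · simpa using this
    · refine pow_le_pow_left' ?_ 2
      rw [enorm_le_iff_norm_le, Pi.sub_apply]
      refine (norm_sub_le _ _).trans ((add_le_add_left (hb k x) _).trans ?_)
      rw [← add_one_mul]
      exact le_abs_self _
    · rw [← eLpNorm_two_sq]
      exact ENNReal.pow_ne_top hw.eLpNorm_ne_top
    · have h1 : Tendsto (fun k => u k x - v x) atTop (𝓝 0) := by
        simpa using (hlim x).sub_const (v x)
      have h2 := ENNReal.Tendsto.pow (n := 2) ((continuous_enorm.tendsto (0 : E)).comp h1)
      simpa using h2
  have h' := ((ENNReal.continuous_rpow_const (y := (1 / 2 : ℝ))).tendsto 0).comp h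
  rw [ENNReal.zero_rpow_of_pos (by norm_num)] at h'
  refine h'.congr fun k => ?_
  simp only [Function.comp]
  rw [← ENNReal.rpow_natCast, ← ENNReal.rpow_mul]
  simp

/-- Multiplication by `φ` need not be bounded on L², so the relation is passed to the limit almost
everywhere along a subsequence common to both sequences. -/
theorem coeFn_eq_mul_of_tendsto {U W : ℕ → Lp ℂ 2 μ} {u w : Lp ℂ 2 μ} {φ : α → ℂ}
    (hU : Tendsto U atTop (𝓝 u)) (hW : Tendsto W atTop (𝓝 w))
    (h : ∀ k, W k =ᵐ[μ] fun x => φ x * U k x) : w =ᵐ[μ] fun x => φ x * u x := by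
  obtain ⟨ns, hns, hns'⟩ := (tendstoInMeasure_of_tendsto_Lp hU).exists_seq_tendsto_ae
  obtain ⟨ms, hms, hms'⟩ := (tendstoInMeasure_of_tendsto_Lp
    (hW.comp hns.tendsto_atTop)).exists_seq_tendsto_ae
  filter_upwards [hns', hms', ae_all_iff.2 h] with x h1 h2 h3
  refine tendsto_nhds_unique h2 ((((h1.comp hms.tendsto_atTop).const_mul (φ x))).congr fun k => ?_)
  simp only [Function.comp, h3]

theorem integrable_of_memLp_two {G : α → E} {s : Set α} (hs : μ s ≠ ∞) (hG : MemLp G 2 μ)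
    (h0 : ∀ᵐ x ∂μ, x ∉ s → G x = 0) : Integrable G μ := by
  have : IsFiniteMeasure (μ.restrict s) := ⟨by simpa using hs.lt_top⟩
  have h : IntegrableOn G s μ := (hG.restrict s).integrable one_le_two
  exact h.integrable_of_ae_notMem_eq_zero h0

end Lp

/-! ### The Fourier–Laplace integral and uniqueness on lines -/

section Transform

variable {V : Type*} [NormedAddCommGroup V] [InnerProductSpace ℝ V]

theorem norm_expKernel_le {x y y' : V} {r : ℝ} (hx : ‖x‖ ≤ r) :
    ‖expKernel x y y'‖ ≤ Real.exp (2 * Real.pi * (r * ‖y'‖)) := by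
  rw [norm_expKernel]
  refine Real.exp_le_exp.2 (mul_le_mul_of_nonneg_left ?_ (by positivity))
  exact (real_inner_le_norm _ _).trans (mul_le_mul_of_nonneg_right hx (norm_nonneg _))

variable [MeasurableSpace V] {μ : Measure V} {G : V → ℂ} {r : ℝ}

theorem norm_expKernel_mul_le (h0 : ∀ᵐ x ∂μ, r < ‖x‖ → G x = 0) :
    ∀ᵐ x ∂μ, ∀ y y', ‖expKernel x y y' * G x‖ ≤ Real.exp (2 * Real.pi * (r * ‖y'‖)) * ‖G x‖ := by
  filter_upwards [h0] with x hx y y'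
  rw [norm_mul]
  rcases le_or_gt ‖x‖ r with h | h
  · exact mul_le_mul_of_nonneg_right (norm_expKernel_le h) (norm_nonneg _)
  · simp [hx h]

variable [BorelSpace V]

theorem aestronglyMeasurable_expKernel_mul (hG : Integrable G μ) (y y' : V) :
    AEStronglyMeasurable (fun x => expKernel x y y' * G x) μ :=
  (continuous_expKernel.comp (f := fun x : V => (x, y, y'))
    (by fun_prop)).aestronglyMeasurable.mul hG.1

theorem integrable_expKernel_mul (hG : Integrable G μ) (h0 : ∀ᵐ x ∂μ, r < ‖x‖ → G x = 0)
    (y y' : V) : Integrable (fun x => expKernel x y y' * G x) μ :=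
  (hG.norm.const_mul (Real.exp (2 * Real.pi * (r * ‖y'‖)))).mono'
    (aestronglyMeasurable_expKernel_mul hG y y')
    ((norm_expKernel_mul_le h0).mono fun _ hx => hx y y')

theorem entireOnLines_integral (hr : 0 ≤ r) (hG : Integrable G μ)
    (h0 : ∀ᵐ x ∂μ, r < ‖x‖ → G x = 0) :
    EntireOnLines fun y y' => ∫ x, expKernel x y y' * G x ∂μ := by
  intro y y' ω
  refine differentiable_integral_of_dominated
    (fun x => (entireOnLines_expKernel x y y' ω).mul_const _)
    (fun w => aestronglyMeasurable_expKernel_mul hG _ _) fun R => ?_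
  refine ⟨fun x => Real.exp (2 * Real.pi * (r * (‖y'‖ + R * ‖ω‖))) * ‖G x‖,
    hG.norm.const_mul _, ?_⟩
  filter_upwards [norm_expKernel_mul_le h0] with x hx w hw
  refine (hx _ _).trans (mul_le_mul_of_nonneg_right (Real.exp_le_exp.2 ?_) (norm_nonneg _))
  refine mul_le_mul_of_nonneg_left (mul_le_mul_of_nonneg_left ?_ hr) (by positivity)
  refine (norm_add_le _ _).trans (add_le_add_right ?_ _)
  rw [norm_smul]
  exact mul_le_mul_of_nonneg_right ((abs_re_le_norm w).trans hw) (norm_nonneg _)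

end Transform

section Identity

variable {V : Type*} [NormedAddCommGroup V] [InnerProductSpace ℝ V]

/-- On the complex line through (y, 0) in direction y', imaginary parameters stay in the slice at 0.
The two entire functions agree on the imaginary axis, hence at w = 1. -/
theorem EntireOnLines.eq_of_eq_zero {g k : V → V → ℂ} (hg : EntireOnLines g)
    (hk : EntireOnLines k) (h : ∀ y, g y 0 = k y 0) (y y' : V) : g y y' = k y y' := by
  have hfreq : ∃ᶠ z : ℂ in 𝓝[≠] 0, g (y - z.im • y') (0 + z.re • y') =
      k (y - z.im • y') (0 + z.re • y') := by
    have hlim : Tendsto (fun t : ℝ => (t : ℂ) * I) (𝓝[≠] 0) (𝓝[≠] 0) := by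
      refine tendsto_nhdsWithin_iff.2 ⟨?_, ?_⟩
      · exact (Continuous.tendsto' (by fun_prop) _ _ (by simp)).mono_left nhdsWithin_le_nhds
      · filter_upwards [self_mem_nhdsWithin] with t ht
        simpa using ht
    refine hlim.frequently (Eventually.frequently (Eventually.of_forall fun t => ?_))
    simpa using h _
  have := AnalyticOnNhd.eq_of_frequently_eq (fun z _ => (hg y 0 y').analyticAt z)
    (fun z _ => (hk y 0 y').analyticAt z) hfreq
  simpa using congrFun this 1

end Identity

/-! ### The scalar Paley–Wiener theorem -/

section PaleyWienerTheorem

variable {V : Type*} [NormedAddCommGroup V] [InnerProductSpace ℝ V]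
  [FiniteDimensional ℝ V] [MeasurableSpace V] [BorelSpace V] {g : V → V → ℂ} {A C : ℝ}

theorem memLp_mul_gauss (hc : Continuous fun p : V × V => g p.1 p.2) {ω : V}
    (h2 : MemLp (g · ω) 2) {ε : ℝ} (hε : 0 ≤ ε) :
    MemLp (fun y => g y ω * gauss ε y ω) 2 := by
  have hm : Continuous fun y : V => g y ω * gauss ε y ω :=
    (hc.mul (continuous_gauss ε)).comp (f := fun y : V => (y, ω)) (by fun_prop)
  refine h2.of_le_mul (c := Real.exp (ε * ‖ω‖ ^ 2)) hm.aestronglyMeasurable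
    (Eventually.of_forall fun y => ?_)
  rw [norm_mul, norm_gauss, mul_comm]
  refine mul_le_mul_of_nonneg_right (Real.exp_le_exp.2 ?_) (norm_nonneg _)
  exact mul_le_mul_of_nonneg_left (by linarith [sq_nonneg ‖y‖]) hε

theorem coeFn_fourierInv_slice_gauss (hA : 0 ≤ A) (hc : Continuous fun p : V × V => g p.1 p.2)
    (hg : EntireOnLines g) (hgr : ExpGrowth g A C) (h0 : MemLp (g · 0) 2) {ω : V}
    (hω : MemLp (g · ω) 2) {ε : ℝ} (hε : 0 < ε) :
    (𝓕⁻ ((memLp_mul_gauss hc hω hε.le).toLp _) : Lp ℂ 2 (volume : Measure V)) =ᵐ[volume] fun x =>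
      expKernel x 0 ω *
        (𝓕⁻ ((memLp_mul_gauss hc h0 hε.le).toLp _) : Lp ℂ 2 (volume : Measure V)) x := by
  filter_upwards [coeFn_fourierInv_toLp (hgr.integrable_mul_gauss hA hc hε 0)
      (memLp_mul_gauss hc h0 hε.le),
    coeFn_fourierInv_toLp (hgr.integrable_mul_gauss hA hc hε ω)
      (memLp_mul_gauss hc hω hε.le)] with x h1 h2
  rw [h1, h2, fourierInv_mul_gauss hA hc hg hgr hε]

theorem tendsto_fourierInv_mul_gauss (hc : Continuous fun p : V × V => g p.1 p.2) {v : V}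
    (hv : MemLp (g · v) 2) {ε : ℕ → ℝ} (hε0 : ∀ k, 0 < ε k) (hε1 : ∀ k, ε k ≤ 1)
    (hε : Tendsto ε atTop (𝓝 0)) : Tendsto
      (fun k => (𝓕⁻ ((memLp_mul_gauss hc hv (hε0 k).le).toLp _) : Lp ℂ 2 (volume : Measure V)))
      atTop (𝓝 (𝓕⁻ (hv.toLp (g · v)))) := by
  have h : Tendsto (fun k => (memLp_mul_gauss hc hv (hε0 k).le).toLp _) atTop
      (𝓝 (hv.toLp (g · v))) := by
    refine tendsto_toLp_of_dominated (c := Real.exp (‖v‖ ^ 2)) _ hv (fun k y => ?_) fun y => ?_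
    · rw [norm_mul, norm_gauss, mul_comm]
      refine mul_le_mul_of_nonneg_right (Real.exp_le_exp.2 ?_) (norm_nonneg _)
      nlinarith [sq_nonneg ‖y‖, sq_nonneg ‖v‖, hε0 k, hε1 k]
    · have h1 : Continuous fun t : ℝ => gauss t y v := by
        unfold gauss
        fun_prop
      have h2 := ((h1.tendsto 0).comp hε).const_mul (g y v)
      simpa [gauss] using h2
  exact ((Lp.fourierTransformₗᵢ V ℂ).symm.continuous.tendsto _).comp h

/-- The inverse Fourier transforms of the slices of `g` differ by an exponential factor. -/
theorem coeFn_fourierInv_slice (hA : 0 ≤ A) (hc : Continuous fun p : V × V => g p.1 p.2)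
    (hg : EntireOnLines g) (hgr : ExpGrowth g A C) (h0 : MemLp (g · 0) 2) {ω : V}
    (hω : MemLp (g · ω) 2) :
    (𝓕⁻ (hω.toLp (g · ω)) : Lp ℂ 2 (volume : Measure V)) =ᵐ[volume] fun x =>
      expKernel x 0 ω * (𝓕⁻ (h0.toLp (g · 0)) : Lp ℂ 2 (volume : Measure V)) x := by
  have hε0 : ∀ k : ℕ, 0 < 1 / ((k : ℝ) + 1) := fun k => by positivity
  have hε1 : ∀ k : ℕ, 1 / ((k : ℝ) + 1) ≤ 1 := fun k => by
    rw [div_le_one (by positivity)]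
    linarith [(Nat.cast_nonneg k : (0 : ℝ) ≤ k)]
  exact coeFn_eq_mul_of_tendsto
    (tendsto_fourierInv_mul_gauss hc h0 hε0 hε1 tendsto_one_div_add_atTop_nhds_zero_nat)
    (tendsto_fourierInv_mul_gauss hc hω hε0 hε1 tendsto_one_div_add_atTop_nhds_zero_nat)
    fun k => coeFn_fourierInv_slice_gauss hA hc hg hgr h0 hω (hε0 k)

omit [FiniteDimensional ℝ V] in
-- Take ω = k d and divide by e^{Ak|d|}: the weighted integrals stay bounded in k, while the
-- integrand blows up wherever 2π x·d > A|d| and G x ≠ 0. Fatou's lemma excludes this up to a null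
-- set, and countably many directions d suffice.
theorem ae_eq_zero_of_eLpNorm_expKernel_le [SecondCountableTopology V] {μ : Measure V} {G : V → ℂ}
    {K : ℝ≥0∞} (hA : 0 ≤ A) (hK : K ≠ ∞) (hG : Measurable G)
    (h : ∀ ω, eLpNorm (fun x => expKernel x 0 ω * G x) 2 μ ≤
      ENNReal.ofReal (Real.exp (A * ‖ω‖)) * K) :
    ∀ᵐ x ∂μ, A < 2 * Real.pi * ‖x‖ → G x = 0 := by
  have hdir : ∀ d : V, ∀ᵐ x ∂μ, A * ‖d‖ < 2 * Real.pi * ⟪x, d⟫ → G x = 0 := by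
    intro d
    set f : ℕ → V → ℝ≥0∞ := fun k x =>
      (ENNReal.ofReal (Real.exp (k * (2 * Real.pi * ⟪x, d⟫ - A * ‖d‖))) * ‖G x‖ₑ) ^ 2 with hf
    have hfm : ∀ k, Measurable (f k) := fun k => by
      refine (Measurable.mul ?_ hG.enorm).pow_const 2
      exact (Continuous.measurable (by fun_prop)).ennreal_ofReal
    have hfi : ∀ k, ∫⁻ x, f k x ∂μ ≤ K ^ 2 := fun k => by
      have e1 : ∀ x, f k x = ENNReal.ofReal (Real.exp (-(A * ‖(k : ℝ) • d‖))) ^ 2 *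
          ‖expKernel x 0 ((k : ℝ) • d) * G x‖ₑ ^ 2 := fun x => by
        rw [hf, ← mul_pow, enorm_mul, ← mul_assoc, ← ofReal_norm (expKernel _ _ _),
          norm_expKernel, ← ENNReal.ofReal_mul (Real.exp_nonneg _), ← Real.exp_add,
          real_inner_smul_right, norm_smul, Real.norm_of_nonneg (Nat.cast_nonneg k)]
        ring_nf
      simp only [e1]
      rw [lintegral_const_mul' _ _ (by finiteness), ← eLpNorm_two_sq, ← mul_pow]
      refine pow_le_pow_left' ((mul_le_mul_right (h _) _).trans_eq ?_) 2
      rw [← mul_assoc, ← ENNReal.ofReal_mul (Real.exp_nonneg _), ← Real.exp_add]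
      simp
    have hlt : ∫⁻ x, liminf (fun k => f k x) atTop ∂μ ≠ ∞ := by
      refine ne_top_of_le_ne_top (ENNReal.pow_ne_top hK (n := 2))
        ((lintegral_liminf_le hfm).trans ?_)
      exact liminf_le_of_le (by isBoundedDefault) fun b hb =>
        hb.exists.elim fun k hk => hk.trans (hfi k)
    filter_upwards [ae_lt_top (Measurable.liminf hfm) hlt] with x hx hd
    by_contra hGx
    refine hx.ne (Tendsto.liminf_eq ?_)
    have h1 : Tendsto (fun k : ℕ => Real.exp (k * (2 * Real.pi * ⟪x, d⟫ - A * ‖d‖))) atTop atTop :=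
      Real.tendsto_exp_atTop.comp
        (tendsto_natCast_atTop_atTop.atTop_mul_const (sub_pos.2 hd))
    have h2 := ENNReal.tendsto_ofReal_atTop.comp h1
    have h3 := ENNReal.Tendsto.mul_const (b := ‖G x‖ₑ) h2 (Or.inr (by simp))
    rw [ENNReal.top_mul (by simpa using hGx)] at h3
    have h4 := ENNReal.Tendsto.pow (n := 2) h3
    simpa using h4
  filter_upwards [ae_all_iff.2 fun k => hdir (TopologicalSpace.denseSeq V k)] with x hx hxA
  have hopen : IsOpen {d : V | A * ‖d‖ < 2 * Real.pi * ⟪x, d⟫} :=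
    isOpen_lt (by fun_prop) (by fun_prop)
  have hx0 : 0 < ‖x‖ := by
    by_contra h0
    have : ‖x‖ = 0 := le_antisymm (not_lt.1 h0) (norm_nonneg _)
    rw [this] at hxA
    linarith
  -- The open set of admissible directions contains d = x, hence a member of the dense sequence.
  obtain ⟨k, hk⟩ := (TopologicalSpace.denseRange_denseSeq V).exists_mem_open hopen
    ⟨x, by
      simp only [Set.mem_ofPred_eq, real_inner_self_eq_norm_sq]
      nlinarith⟩
  exact hx k hk

/-- A theorem of Paley–Wiener–Plancherel–Pólya type. -/
theorem exists_eq_integral_expKernel (hA : 0 ≤ A) (hc : Continuous fun p : V × V => g p.1 p.2)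
    (hg : EntireOnLines g) (hgr : ExpGrowth g A C) (h0 : MemLp (g · 0) 2) :
    ∃ G : V → ℂ, MemLp G 2 ∧ (∀ᵐ x, A / (2 * Real.pi) < ‖x‖ → G x = 0) ∧
      ∀ y y', g y y' = ∫ x, expKernel x y y' * G x := by
  have hcω : ∀ ω, Continuous (g · ω) := fun ω => hc.comp (f := fun y : V => (y, ω)) (by fun_prop)
  set u := h0.toLp (g · 0) with hu
  set G : Lp ℂ 2 (volume : Measure V) := 𝓕⁻ u with hG
  have hω : ∀ ω, MemLp (g · ω) 2 := fun ω =>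
    ⟨(hcω ω).aestronglyMeasurable, (eLpNorm_le_of_expGrowth hA hc hg hgr h0 ω).trans_lt
      (ENNReal.mul_lt_top ENNReal.ofReal_lt_top h0.2)⟩
  have hsupp : ∀ᵐ x, A < 2 * Real.pi * ‖x‖ → G x = 0 := by
    refine ae_eq_zero_of_eLpNorm_expKernel_le hA h0.eLpNorm_ne_top (Lp.stronglyMeasurable G).measurable
      fun ω => ?_
    rw [← eLpNorm_congr_ae (coeFn_fourierInv_slice hA hc hg hgr h0 (hω ω)), ← Lp.enorm_def]
    refine le_trans (le_of_eq ?_) (eLpNorm_le_of_expGrowth hA hc hg hgr h0 ω)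
    rw [← Lp.enorm_toLp (hf := hω ω), ← ofReal_norm, ← ofReal_norm]
    exact congrArg _ ((Lp.fourierTransformₗᵢ V ℂ).symm.norm_map _)
  have hsupp' : ∀ᵐ x, A / (2 * Real.pi) < ‖x‖ → G x = 0 := by
    filter_upwards [hsupp] with x hx h
    exact hx (by rwa [div_lt_iff₀' (by positivity)] at h)
  have hGi : Integrable G := by
    refine integrable_of_memLp_two (s := Metric.closedBall 0 (A / (2 * Real.pi)))
      measure_closedBall_lt_top.ne (Lp.memLp G) ?_
    filter_upwards [hsupp'] with x hx h
    exact hx (by simpa using h)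
  refine ⟨G, Lp.memLp G, hsupp', ?_⟩
  refine hg.eq_of_eq_zero (entireOnLines_integral (by positivity) hGi hsupp') ?_
  have h1 : 𝓕 (G : V → ℂ) =ᵐ[volume] (g · 0) := by
    have h := coeFn_fourier_toLp hGi (Lp.memLp G)
    rw [Lp.toLp_coeFn, hG, FourierTransform.fourier_fourierInv_eq] at h
    exact h.symm.trans h0.coeFn_toLp
  -- Both sides are continuous, so Fourier inversion holds at every point of the slice.
  rw [Continuous.ae_eq_iff_eq _ (continuous_fourier hGi) (hcω 0)] at h1
  intro y
  rw [← congrFun h1 y, Real.fourier_eq]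
  refine integral_congr_ae (Eventually.of_forall fun x => ?_)
  simp only [Circle.smul_def, Real.fourierChar_apply, expKernel, smul_eq_mul]
  congr 2
  simp
  ring

end PaleyWienerTheorem

end PaleyWiener

namespace CliffordFourier

/-! ### Isometry and commutation of the bivectors -/

section Algebra

variable {n : ℕ}

theorem scalarPart_listProd_of_odd {l : List (Fin n ⊕ Fin n)} {j : Fin n ⊕ Fin n}
    (h : Odd (l.count j)) : scalarPart n (listProd l) = 0 := by
  obtain ⟨l', hn, hm, hp⟩ := listProd_reduce l
  have hne : l' ≠ [] := List.ne_nil_of_mem ((hm j).2 h)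
  rcases hp with hp | hp <;> simp [hp, scalarPart_listProd hn, hne]

theorem listProd_of_not_odd {l : List (Fin n ⊕ Fin n)} (h : ∀ j, ¬ Odd (l.count j)) :
    listProd l = 1 ∨ listProd l = -1 := by
  obtain ⟨l', -, hm, hp⟩ := listProd_reduce l
  have hl : l' = [] := List.eq_nil_iff_forall_not_mem.2 fun j hj => h j ((hm j).1 hj)
  simpa [hl, listProd_nil] using hp

/-- Two extra factors `gen j` change no parity of occurrence, so if some index occurs an odd number
of times both scalar parts vanish; otherwise the blade is ±1. Applied to a a†, this makes left
multiplication by a basis vector isometric. -/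
theorem scalarPart_gen_mul_mul_gen (j : Fin n ⊕ Fin n) (x : G n) :
    scalarPart n (gen j * x * gen j) = scalarPart n x := by
  obtain ⟨c, rfl⟩ := exists_blade_sum x
  simp only [Finset.mul_sum, Finset.sum_mul, map_sum, mul_smul_comm, smul_mul_assoc, map_smul]
  refine Finset.sum_congr rfl fun S _ => congrArg _ ?_
  rw [blade]
  generalize S.toList = l
  by_cases h : ∃ k, Odd (l.count k)
  · obtain ⟨k, hk⟩ := h
    have e1 : gen j * listProd l * gen j = listProd (j :: (l ++ [j])) := by
      rw [listProd_cons, listProd_append, listProd_cons, listProd_nil, mul_one, mul_assoc]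
    rw [e1, scalarPart_listProd_of_odd hk, scalarPart_listProd_of_odd (j := k)]
    rw [List.count_cons, List.count_append, List.count_singleton, add_assoc]
    exact hk.add_even ⟨_, rfl⟩
  · rcases listProd_of_not_odd (not_exists.1 h) with h | h <;> simp [h, gen_mul_self]

theorem norm_gen_mul (j : Fin n ⊕ Fin n) (a : G n) : ‖gen j * a‖ = ‖a‖ := by
  rw [← sq_eq_sq₀ (norm_nonneg _) (norm_nonneg _), ← real_inner_self_eq_norm_sq,
    ← real_inner_self_eq_norm_sq, inner_eq, inner_eq, CliffordAlgebra.reverse.map_mul, gen,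
    CliffordAlgebra.reverse_ι, ← gen, ← mul_assoc, mul_assoc (gen j), scalarPart_gen_mul_mul_gen]

theorem norm_biv_mul (i : Fin n) (a : G n) : ‖biv i * a‖ = ‖a‖ := by
  rw [biv, mul_assoc, e, e', norm_gen_mul, norm_gen_mul]

theorem e_mul_self (i : Fin n) : (e i * e i : G n) = 1 := gen_mul_self _

theorem e'_mul_self (i : Fin n) : (e' i * e' i : G n) = 1 := gen_mul_self _

theorem e_mul_biv (i : Fin n) : (e i * biv i : G n) = e' i := by
  rw [biv, ← mul_assoc, e_mul_self, one_mul]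

theorem e'_mul_e (i : Fin n) : (e' i * e i : G n) = -biv i :=
  gen_mul_gen (by simp)

theorem biv_mul_self (i : Fin n) : (biv i * biv i : G n) = -1 := by
  calc (biv i * biv i : G n) = e i * (e' i * e i) * e' i := by simp only [biv, mul_assoc]
    _ = -(e i * e i * (e' i * e' i)) := by rw [e'_mul_e, biv]; simp only [mul_assoc, mul_neg, neg_mul]
    _ = -1 := by rw [e_mul_self, e'_mul_self, mul_one]

theorem biv_mul_gen {i : Fin n} {j : Fin n ⊕ Fin n} (h : Sum.inl i ≠ j) (h' : Sum.inr i ≠ j) :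
    (biv i * gen j : G n) = gen j * biv i := by
  rw [biv, e, e', mul_assoc, gen_mul_gen h', mul_neg, ← mul_assoc, gen_mul_gen h, neg_mul,
    neg_neg, mul_assoc]

theorem biv_mul_biv (i k : Fin n) : (biv i * biv k : G n) = biv k * biv i := by
  by_cases h : i = k
  · rw [h]
  · have h1 : (biv i * e k : G n) = e k * biv i := biv_mul_gen (by simpa using h) (by simp)
    have h2 : (biv i * e' k : G n) = e' k * biv i := biv_mul_gen (by simp) (by simpa using h)
    calc (biv i * biv k : G n) = biv i * e k * e' k := by simp only [biv, mul_assoc]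
      _ = biv k * biv i := by rw [h1, mul_assoc, h2, ← mul_assoc]; rfl

end Algebra

/-! ### Simultaneous diagonalization of commuting complex structures -/

section Spectral

variable {V I : Type*} [NormedAddCommGroup V] [InnerProductSpace ℝ V] [FiniteDimensional ℝ V]

/-- Linear maps to and from `ℂ` which diagonalize the operators `B i`, `i ∈ s`, with
eigenvalues `± i`. -/
structure SpectralFamily (B : I → V →ₗ[ℝ] V) (s : Set I) (ι : Type) [Fintype ι] where
  /-- the signs of the eigenvalues -/
  sign : ι → I → ℝ
  /-- the coordinates -/
  coord : ι → V →ₗ[ℝ] ℂ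
  /-- the inverse of the coordinates -/
  incl : ι → ℂ →ₗ[ℝ] V
  sign_eq : ∀ j i, sign j i = 1 ∨ sign j i = -1
  coord_apply : ∀ j, ∀ i ∈ s, ∀ a, coord j (B i a) = Complex.I * sign j i * coord j a
  apply_incl : ∀ j, ∀ i ∈ s, ∀ w, B i (incl j w) = incl j (Complex.I * sign j i * w)
  -- Only reconstruction and Parseval's identity are required. The coordinates may be redundant, so
  -- no eigenspaces have to be chosen.
  sum_incl : ∀ a, ∑ j, incl j (coord j a) = a
  sum_norm_sq : ∀ a, ∑ j, ‖coord j a‖ ^ 2 = ‖a‖ ^ 2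

/-- The family of coordinates with respect to an orthonormal basis. -/
noncomputable def SpectralFamily.ofEmpty (B : I → V →ₗ[ℝ] V) :
    SpectralFamily B ∅ (Fin (Module.finrank ℝ V)) where
  sign _ _ := 1
  coord j := Complex.ofRealCLM.toLinearMap ∘ₗ innerₗ V (stdOrthonormalBasis ℝ V j)
  incl j := Complex.reLm.smulRight (stdOrthonormalBasis ℝ V j)
  sign_eq _ _ := Or.inl rfl
  coord_apply _ _ h := h.elim
  apply_incl _ _ h := h.elim
  sum_incl a := by simpa using (stdOrthonormalBasis ℝ V).sum_repr' a
  sum_norm_sq a := by simpa using (stdOrthonormalBasis ℝ V).sum_sq_norm_inner_right a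

/-- The sign `± 1` attached to a boolean. -/
noncomputable def boolSign (t : Bool) : ℝ := if t then 1 else -1

theorem boolSign_mul_self (t : Bool) : ((boolSign t : ℝ) : ℂ) * boolSign t = 1 := by
  cases t <;> simp [boolSign]

/-- Diagonalization of one more operator. -/
noncomputable def SpectralFamily.insert [DecidableEq I] {B : I → V →ₗ[ℝ] V} {s : Set I} {ι : Type} [Fintype ι]
    (T : SpectralFamily B s ι) (k : I) (hcomm : ∀ i a, B i (B k a) = B k (B i a))
    (hsq : ∀ a, B k (B k a) = -a) (hnorm : ∀ a, ‖B k a‖ = ‖a‖) :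
    SpectralFamily B (Insert.insert k s) (ι × Bool) where
  sign p := Function.update (T.sign p.1) k (boolSign p.2)
  -- With σ = `boolSign p.2`, this composes the old coordinate with the spectral projection (1 -
  -- iσB)/2 onto the eigenvalue iσ of B, where B² = -1; `incl` is built dually.
  coord p := (1 / 2 : ℝ) • (T.coord p.1 - (Complex.I * boolSign p.2) • (T.coord p.1 ∘ₗ B k))
  incl p := (1 / 2 : ℝ) • (T.incl p.1 -
    boolSign p.2 • (B k ∘ₗ T.incl p.1 ∘ₗ LinearMap.mulLeft ℝ Complex.I))
  sign_eq p i := by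
    by_cases h : i = k
    · subst h
      cases p.2 <;> simp [boolSign]
    · simpa [h] using T.sign_eq p.1 i
  coord_apply p i hi a := by
    by_cases h : i = k
    · subst h
      simp only [LinearMap.smul_apply, LinearMap.sub_apply, LinearMap.comp_apply, hsq, map_neg,
        smul_eq_mul, Function.update_self, Complex.real_smul]
      push_cast
      linear_combination (-(1 / 2) * T.coord p.1 (B i a)) * boolSign_mul_self p.2 +
        (1 / 2 * boolSign p.2 * boolSign p.2 * T.coord p.1 (B i a)) * Complex.I_mul_I
    · have hs : i ∈ s := hi.resolve_left h
      simp only [LinearMap.smul_apply, LinearMap.sub_apply, LinearMap.comp_apply, ← hcomm i,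
        T.coord_apply _ i hs, smul_eq_mul, Function.update_of_ne h, Complex.real_smul]
      ring
  apply_incl p i hi w := by
    by_cases h : i = k
    · subst h
      have h1 : Complex.I * ((boolSign p.2 : ℝ) : ℂ) * w = boolSign p.2 • (Complex.I * w) := by
        rw [Complex.real_smul]; ring
      have h2 : Complex.I * (Complex.I * w) = -w := by
        rw [← mul_assoc, Complex.I_mul_I, neg_one_mul]
      have h3 : boolSign p.2 • boolSign p.2 • B i (T.incl p.1 w) = B i (T.incl p.1 w) := by
        rw [smul_smul, (by exact_mod_cast boolSign_mul_self p.2 : boolSign p.2 * boolSign p.2 = 1),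
          one_smul]
      simp only [LinearMap.smul_apply, LinearMap.sub_apply, LinearMap.comp_apply,
        Function.update_self, LinearMap.mulLeft_apply, map_smul, map_sub, hsq, h1, map_neg,
        h2]
      linear_combination (norm := module) (-(1 / 2 : ℝ)) • h3
    · have hs : i ∈ s := hi.resolve_left h
      have h1 : Complex.I * (Complex.I * T.sign p.1 i * w) =
          Complex.I * T.sign p.1 i * (Complex.I * w) := by ring
      simp only [LinearMap.smul_apply, LinearMap.sub_apply, LinearMap.comp_apply, map_smul, map_sub,
        hcomm i, T.apply_incl _ i hs, Function.update_of_ne h, LinearMap.mulLeft_apply, h1]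
  sum_incl a := by
    have key : ∀ j, ∑ t : Bool, (1 / 2 : ℝ) • (T.incl j -
        boolSign t • (B k ∘ₗ T.incl j ∘ₗ LinearMap.mulLeft ℝ Complex.I))
          (((1 / 2 : ℝ) • (T.coord j - (Complex.I * boolSign t) • (T.coord j ∘ₗ B k))) a) =
        (1 / 2 : ℝ) • (T.incl j (T.coord j a) - B k (T.incl j (T.coord j (B k a)))) := fun j => by
      have h1 : Complex.I * (Complex.I * T.coord j (B k a)) = -T.coord j (B k a) := by
        rw [← mul_assoc, Complex.I_mul_I, neg_one_mul]
      simp only [Fintype.sum_bool, boolSign, if_true, Bool.false_eq_true, if_false,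
        Complex.ofReal_one, mul_one, Complex.ofReal_neg, mul_neg, LinearMap.smul_apply,
        LinearMap.sub_apply, LinearMap.comp_apply, LinearMap.mulLeft_apply,
        smul_eq_mul, map_sub, map_smul, h1, map_neg, neg_mul, one_smul, neg_smul]
      module
    rw [Fintype.sum_prod_type]
    simp only [LinearMap.smul_apply] at key ⊢
    simp only [key]
    rw [← Finset.smul_sum, Finset.sum_sub_distrib, ← map_sum, T.sum_incl, T.sum_incl, hsq]
    module
  sum_norm_sq a := by
    have key : ∀ j, ∑ t : Bool,
        ‖((1 / 2 : ℝ) • (T.coord j - (Complex.I * boolSign t) • (T.coord j ∘ₗ B k))) a‖ ^ 2 =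
        (1 / 2 : ℝ) * (‖T.coord j a‖ ^ 2 + ‖T.coord j (B k a)‖ ^ 2) := fun j => by
      -- The cross terms of the two signs cancel by the parallelogram law; isometry of `B k` then
      -- restores the full norm in the sum over `j`.
      have h := parallelogram_law_with_norm ℝ (T.coord j a) (Complex.I * T.coord j (B k a))
      rw [norm_mul, Complex.norm_I, one_mul] at h
      simp only [LinearMap.smul_apply, LinearMap.sub_apply, LinearMap.comp_apply, norm_smul,
        Fintype.sum_bool, boolSign, smul_eq_mul]
      simp only [if_true, Bool.false_eq_true, if_false, Complex.ofReal_one, mul_one,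
        Complex.ofReal_neg, mul_neg, neg_mul, sub_neg_eq_add, mul_pow]
      norm_num
      linarith
    rw [Fintype.sum_prod_type]
    simp only [key]
    rw [← Finset.mul_sum, Finset.sum_add_distrib, T.sum_norm_sq, T.sum_norm_sq, hnorm]
    ring

theorem exists_spectralFamily [Finite I] (B : I → V →ₗ[ℝ] V)
    (hcomm : ∀ i k a, B i (B k a) = B k (B i a)) (hsq : ∀ k a, B k (B k a) = -a)
    (hnorm : ∀ k a, ‖B k a‖ = ‖a‖) :
    ∃ (ι : Type) (_ : Fintype ι), Nonempty (SpectralFamily B Set.univ ι) := by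
  classical
  refine Set.Finite.induction_on (motive := fun s _ =>
    ∃ (ι : Type) (_ : Fintype ι), Nonempty (SpectralFamily B s ι)) _ Set.finite_univ ?_ ?_
  · exact ⟨_, _, ⟨SpectralFamily.ofEmpty B⟩⟩
  · rintro k s - - ⟨ι, _, ⟨T⟩⟩
    exact ⟨_, _, ⟨T.insert k (fun i => hcomm i k) (hsq k) (hnorm k)⟩⟩

end Spectral

end CliffordFourier

namespace CliffordFourier

open PaleyWiener Complex Filter Topology
open scoped RealInnerProductSpace

/-! ### The Clifford exponential -/

section Exponential

variable {n : ℕ}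

/-- The Clifford norm is not submultiplicative in general, so convergence is taken from the operator
exponential of left multiplication by `M`, evaluated at 1. -/
theorem hasSum_exp (M : G n) :
    HasSum (fun k : ℕ => ((k.factorial : ℝ)⁻¹) • M ^ k) (NormedSpace.exp M) := by
  have : CompleteSpace (G n) := FiniteDimensional.complete ℝ (G n)
  let L : G n →L[ℝ] G n := LinearMap.toContinuousLinearMap (LinearMap.mulLeft ℝ M)
  have h := (NormedSpace.exp_series_hasSum_exp' (𝕂 := ℝ) L).mapL
    (ContinuousLinearMap.apply ℝ (G n) (1 : G n))
  have hL : ∀ k : ℕ, (L ^ k) 1 = M ^ k := fun k => by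
    induction k with
    | zero => simp
    | succ k ih =>
      rw [pow_succ', pow_succ', ← ih]
      rfl
  simp only [map_smul, ContinuousLinearMap.apply_apply, hL] at h
  have h2 : NormedSpace.exp M = ∑' k : ℕ, ((k.factorial : ℝ)⁻¹) • M ^ k := by
    rw [NormedSpace.exp_eq_tsum ℝ]
  rw [h2]
  exact h.summable.hasSum

theorem apply_exp_mul (φ : G n →ₗ[ℝ] ℂ) {M : G n} {μ : ℂ} (h : ∀ a, φ (M * a) = μ * φ a) (a : G n) :
    φ (NormedSpace.exp M * a) = cexp μ * φ a := by
  have hpow : ∀ k : ℕ, φ (M ^ k * a) = μ ^ k * φ a := fun k => by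
    induction k with
    | zero => simp
    | succ k ih => rw [pow_succ', mul_assoc, h, ih, pow_succ']; ring
  have h1 := (hasSum_exp M).mapL
    (LinearMap.toContinuousLinearMap (φ ∘ₗ LinearMap.mulRight ℝ a))
  simp only [map_smul, LinearMap.coe_toContinuousLinearMap', LinearMap.comp_apply,
    LinearMap.mulRight_apply, hpow] at h1
  have h2 := (NormedSpace.exp_series_hasSum_exp' (𝕂 := ℝ) μ).mul_right (φ a)
  simp only [smul_mul_assoc, ← Complex.exp_eq_exp_ℂ] at h2
  exact h1.unique h2

theorem exp_mul_apply (τ : ℂ →ₗ[ℝ] G n) {M : G n} {μ : ℂ} (h : ∀ w, M * τ w = τ (μ * w)) (w : ℂ) :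
    NormedSpace.exp M * τ w = τ (cexp μ * w) := by
  have hpow : ∀ k : ℕ, M ^ k * τ w = τ (μ ^ k * w) := fun k => by
    induction k with
    | zero => simp
    | succ k ih => rw [pow_succ', mul_assoc, ih, h, pow_succ', mul_assoc]
  have h1 := (hasSum_exp M).mapL
    (LinearMap.toContinuousLinearMap (LinearMap.mulRight ℝ (τ w)))
  simp only [map_smul, LinearMap.coe_toContinuousLinearMap',
    LinearMap.mulRight_apply, hpow] at h1
  have h2 := (NormedSpace.exp_series_hasSum_exp' (𝕂 := ℝ) μ).mapL
    (LinearMap.toContinuousLinearMap (τ ∘ₗ LinearMap.mulRight ℝ w))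
  simp only [map_smul, LinearMap.coe_toContinuousLinearMap', LinearMap.comp_apply,
    LinearMap.mulRight_apply, ← Complex.exp_eq_exp_ℂ] at h2
  exact h1.unique h2

/-- Because B_i e_i e_i = B_i and B_i e_i e'_i = B_i² = -1, the primed variable enters through a
scalar and the unprimed one through commuting bivectors. -/
theorem bilinI_pt (x y y' : Rn n) :
    bilinI (pt x 0) (pt y y') = ∑ i, (x i * y i) • biv i - algebraMap ℝ (G n) ⟪x, y'⟫ := by
  have e1 : ∀ i : Fin n, biv i * proj i (pt x 0) * proj i (pt y y') =
      (x i * y i) • biv i - algebraMap ℝ (G n) (x i * y' i) := fun i => by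
    have h1 : (biv i * e i * e' i : G n) = -1 := by rw [mul_assoc, ← biv, biv_mul_self]
    have h2 : (biv i * e i * e i : G n) = biv i := by rw [mul_assoc, e_mul_self, mul_one]
    simp only [proj, pt, Sum.elim_inl, Sum.elim_inr, PiLp.zero_apply, zero_smul, add_zero,
      mul_smul_comm, smul_mul_assoc, mul_add, h1, h2, Algebra.algebraMap_eq_smul_one]
    module
  rw [bilinI, Finset.sum_congr rfl fun i _ => e1 i, Finset.sum_sub_distrib, ← map_sum]
  congr 2
  simp [PiLp.inner_apply, mul_comm]

end Exponential

section Points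

variable {n : ℕ}

/-- The `ℝⁿ`-component of a point of `ℝ²ⁿ` along `e_1, …, e_n`. -/
noncomputable def unprimed (y : R2n n) : Rn n := WithLp.toLp 2 fun i => y (Sum.inl i)

/-- The `ℝⁿ`-component of a point of `ℝ²ⁿ` along `e'_1, …, e'_n`. -/
noncomputable def primed (y : R2n n) : Rn n := WithLp.toLp 2 fun i => y (Sum.inr i)

theorem pt_unprimed_primed (y : R2n n) : pt (unprimed y) (primed y) = y := by
  ext i
  cases i <;> rfl

theorem norm_sq_pt (y y' : Rn n) : ‖pt y y'‖ ^ 2 = ‖y‖ ^ 2 + ‖y'‖ ^ 2 := by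
  simp [EuclideanSpace.norm_sq_eq, pt]

theorem norm_pt_le (y y' : Rn n) : ‖pt y y'‖ ≤ ‖y‖ + ‖y'‖ := by
  refine (sq_le_sq₀ (by positivity) (by positivity)).1 ?_
  rw [norm_sq_pt]
  nlinarith [norm_nonneg y, norm_nonneg y']

theorem norm_le_norm_pt (y y' : Rn n) : ‖y'‖ ≤ ‖pt y y'‖ := by
  refine (sq_le_sq₀ (by positivity) (by positivity)).1 ?_
  rw [norm_sq_pt]
  nlinarith [norm_nonneg y]

theorem continuous_pt : Continuous fun p : Rn n × Rn n => pt p.1 p.2 := by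
  unfold pt
  refine (PiLp.continuous_toLp 2 _).comp (continuous_pi fun i => ?_)
  cases i <;> simp only [Sum.elim_inl, Sum.elim_inr] <;> fun_prop

/-- The diagonal isometry with the given signs. -/
noncomputable def signFlip (s : Fin n → ℝ) : Rn n ≃ₗᵢ[ℝ] Rn n :=
  LinearIsometryEquiv.piLpCongrRight 2 fun i =>
    if s i = 1 then LinearIsometryEquiv.refl ℝ ℝ else LinearIsometryEquiv.neg ℝ

variable {s : Fin n → ℝ}

theorem signFlip_apply (hs : ∀ i, s i = 1 ∨ s i = -1) (y : Rn n) (i : Fin n) :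
    signFlip s y i = s i * y i := by
  rcases hs i with h | h
  · simp [signFlip, h]
  · have : ¬ ((-1 : ℝ) = 1) := by norm_num
    simp [signFlip, h, this]

theorem signFlip_signFlip (hs : ∀ i, s i = 1 ∨ s i = -1) (y : Rn n) :
    signFlip s (signFlip s y) = y := by
  ext i
  rw [signFlip_apply hs, signFlip_apply hs]
  rcases hs i with h | h <;> simp [h]

end Points

/-! ### The kernel in spectral coordinates -/

section Kernel

variable {n : ℕ} {ι : Type} [Fintype ι]

/-- A spectral family for the left multiplications by the bivectors `B_i`. -/
abbrev BivFamily (n : ℕ) (ι : Type) [Fintype ι] : Type :=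
  SpectralFamily (fun i : Fin n => LinearMap.mulLeft ℝ (biv i : G n)) Set.univ ι

theorem exists_bivFamily (n : ℕ) : ∃ (ι : Type) (_ : Fintype ι), Nonempty (BivFamily n ι) := by
  refine exists_spectralFamily _ (fun i k a => ?_) (fun k a => ?_) fun k a => ?_
  · simp only [LinearMap.mulLeft_apply, ← mul_assoc, biv_mul_biv i k]
  · simp only [LinearMap.mulLeft_apply, ← mul_assoc, biv_mul_self, neg_one_mul]
  · exact norm_biv_mul k a

variable (T : BivFamily n ι)

theorem coord_biv_mul (j : ι) (i : Fin n) (a : G n) :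
    T.coord j (biv i * a) = I * T.sign j i * T.coord j a :=
  T.coord_apply j i (Set.mem_univ i) a

theorem biv_mul_incl (j : ι) (i : Fin n) (w : ℂ) :
    biv i * T.incl j w = T.incl j (I * T.sign j i * w) :=
  T.apply_incl j i (Set.mem_univ i) w

theorem norm_coord_le (j : ι) (a : G n) : ‖T.coord j a‖ ≤ ‖a‖ := by
  refine (sq_le_sq₀ (by positivity) (by positivity)).1 ?_
  rw [← T.sum_norm_sq a]
  exact Finset.single_le_sum (f := fun j => ‖T.coord j a‖ ^ 2) (fun _ _ => by positivity)
    (Finset.mem_univ j)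

theorem norm_le_sum_coord (a : G n) : ‖a‖ ≤ ∑ j, ‖T.coord j a‖ := by
  refine (sq_le_sq₀ (by positivity) (by positivity)).1 ?_
  rw [← T.sum_norm_sq a]
  exact Finset.sum_sq_le_sq_sum_of_nonneg fun _ _ => norm_nonneg _

theorem sum_enorm_sq (a : G n) : ∑ j, ‖T.coord j a‖ₑ ^ 2 = ‖a‖ₑ ^ 2 := by
  simp only [← ofReal_norm, ← ENNReal.ofReal_pow (norm_nonneg _)]
  rw [← ENNReal.ofReal_sum_of_nonneg fun _ _ => by positivity, T.sum_norm_sq]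

theorem eq_zero_of_coord {a : G n} (h : ∀ j, T.coord j a = 0) : a = 0 := by
  rw [← T.sum_incl a]
  simp [h]

/-- The rescaling passes from the convention e^{-2πi x·y} of the scalar theory to e^{-i x·y}. -/
theorem two_pi_expKernel (x y y' : Rn n) :
    expKernel x ((2 * Real.pi)⁻¹ • y) ((2 * Real.pi)⁻¹ • y') = cexp (⟪x, y'⟫ - I * ⟪x, y⟫) := by
  rw [expKernel, real_inner_smul_right, real_inner_smul_right]
  congr 1
  have : (Real.pi : ℂ) ≠ 0 := by exact_mod_cast Real.pi_ne_zero
  push_cast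
  field_simp

theorem sum_sign_eq_inner (j : ι) (x y : Rn n) :
    ∑ i, (x i * y i : ℝ) * (I * T.sign j i) = I * (⟪x, signFlip (T.sign j) y⟫ : ℝ) := by
  simp only [PiLp.inner_apply, signFlip_apply (T.sign_eq j), ofReal_sum, Finset.mul_sum]
  refine Finset.sum_congr rfl fun i _ => ?_
  simp
  ring

/-- The kernel acts on the coordinates as a scalar exponential. -/
theorem coord_kernel_mul (j : ι) (x y y' : Rn n) (a : G n) :
    T.coord j (kernel x (pt y y') * a) =
      expKernel x ((2 * Real.pi)⁻¹ • signFlip (T.sign j) y) ((2 * Real.pi)⁻¹ • y') *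
        T.coord j a := by
  rw [two_pi_expKernel, kernel]
  refine apply_exp_mul _ (fun a => ?_) a
  rw [bilinI_pt, neg_mul, sub_mul, Finset.sum_mul, ← sum_sign_eq_inner, ← Algebra.smul_def]
  simp only [map_neg, map_sub, map_sum, smul_mul_assoc, map_smul, coord_biv_mul, real_smul]
  rw [sub_mul, Finset.sum_mul]
  simp only [mul_assoc]
  ring

theorem kernel_mul_incl (j : ι) (x y y' : Rn n) (w : ℂ) :
    kernel x (pt y y') * T.incl j w = T.incl j
      (expKernel x ((2 * Real.pi)⁻¹ • signFlip (T.sign j) y) ((2 * Real.pi)⁻¹ • y') * w) := by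
  rw [two_pi_expKernel, kernel]
  refine exp_mul_apply _ (fun w => ?_) w
  rw [bilinI_pt, neg_mul, sub_mul, Finset.sum_mul, ← sum_sign_eq_inner, ← Algebra.smul_def]
  simp only [smul_mul_assoc, biv_mul_incl, ← map_smul, ← map_sum, ← map_sub, ← map_neg, real_smul]
  congr 1
  rw [sub_mul, Finset.sum_mul]
  simp only [mul_assoc]
  ring

end Kernel

end CliffordFourier

namespace CliffordFourier

open PaleyWiener Complex Filter Topology FourierTransform
open scoped RealInnerProductSpace

/-! ### Differentiation under the integral sign -/

section Parametric

variable {V E : Type*} [NormedAddCommGroup V] [MeasurableSpace V] [BorelSpace V] [ProperSpace V]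
  [NormedAddCommGroup E] [NormedSpace ℝ E] {μ : Measure V} {Λ : V → E →L[ℝ] ℂ} {Φ : V → ℂ} {r : ℝ}

omit [BorelSpace V] in
theorem exists_norm_integrand_le (hΛ : Continuous Λ) (h0 : ∀ᵐ x ∂μ, r < ‖x‖ → Φ x = 0) (y₀ : E) :
    ∃ K, 0 ≤ K ∧ ∀ᵐ x ∂μ, ∀ y ∈ Metric.ball y₀ 1, ‖cexp (Λ x y) * Φ x‖ ≤ K * ‖Φ x‖ ∧
      ‖(cexp (Λ x y) * Φ x) • Λ x‖ ≤ K * ‖Φ x‖ := by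
  obtain ⟨L, hL⟩ := (isCompact_closedBall (0 : V) r).exists_bound_of_continuousOn hΛ.continuousOn
  have hL' : ∀ x, ‖x‖ ≤ r → ‖Λ x‖ ≤ max L 0 := fun x hx =>
    (hL x (by simpa using hx)).trans (le_max_left _ _)
  set M := max L 0 with hM
  have hM0 : 0 ≤ M := le_max_right _ _
  -- `M` bounds |Λ x| on the ball carrying Φ; the factor 1 + M serves the integrand and its
  -- derivative at once.
  refine ⟨Real.exp (M * (‖y₀‖ + 1)) * (1 + M), by positivity, ?_⟩
  filter_upwards [h0] with x hx y hy
  rcases le_or_gt ‖x‖ r with h | h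
  · have hy' : ‖y‖ ≤ ‖y₀‖ + 1 := by
      have := norm_sub_norm_le y y₀
      rw [mem_ball_iff_norm] at hy
      linarith
    have h1 : ‖cexp (Λ x y)‖ ≤ Real.exp (M * (‖y₀‖ + 1)) := by
      rw [norm_exp]
      refine Real.exp_le_exp.2 ((re_le_norm _).trans (((Λ x).le_opNorm y).trans ?_))
      exact mul_le_mul (hL' x h) hy' (norm_nonneg _) hM0
    have h2 : ‖cexp (Λ x y) * Φ x‖ ≤ Real.exp (M * (‖y₀‖ + 1)) * ‖Φ x‖ := by
      rw [norm_mul]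
      exact mul_le_mul_of_nonneg_right h1 (norm_nonneg _)
    have h3 : 0 ≤ Real.exp (M * (‖y₀‖ + 1)) * ‖Φ x‖ := by positivity
    refine ⟨h2.trans ?_, ?_⟩
    · nlinarith
    · rw [norm_smul]
      refine (mul_le_mul h2 (hL' x h) (norm_nonneg _) h3).trans ?_
      nlinarith
  · simp [hx h, norm_smul]

theorem hasFDerivAt_integral_cexp (hΛ : Continuous Λ) (hΦ : Integrable Φ μ)
    (h0 : ∀ᵐ x ∂μ, r < ‖x‖ → Φ x = 0) (y₀ : E) :
    HasFDerivAt (fun y => ∫ x, cexp (Λ x y) * Φ x ∂μ)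
      (∫ x, (cexp (Λ x y₀) * Φ x) • Λ x ∂μ) y₀ ∧
    ContinuousAt (fun y => ∫ x, (cexp (Λ x y) * Φ x) • Λ x ∂μ) y₀ ∧
    Integrable (fun x => (cexp (Λ x y₀) * Φ x) • Λ x) μ := by
  obtain ⟨K, hK, hb⟩ := exists_norm_integrand_le hΛ h0 y₀
  have hm : ∀ y, AEStronglyMeasurable (fun x => cexp (Λ x y) * Φ x) μ := fun y =>
    (Continuous.aestronglyMeasurable (by fun_prop)).mul hΦ.1
  have hm' : ∀ y, AEStronglyMeasurable (fun x => (cexp (Λ x y) * Φ x) • Λ x) μ := fun y =>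
    (hm y).smul hΛ.aestronglyMeasurable
  have hbi : Integrable (fun x => K * ‖Φ x‖) μ := hΦ.norm.const_mul _
  have hball := Metric.ball_mem_nhds y₀ one_pos
  refine ⟨hasFDerivAt_integral_of_dominated_of_fderiv_le
    (F' := fun y x => (cexp (Λ x y) * Φ x) • Λ x) (bound := fun x => K * ‖Φ x‖) hball
    (Eventually.of_forall hm) (hbi.mono' (hm y₀) ?_) (hm' y₀) ?_ hbi
    (Eventually.of_forall fun x y _ => ?_), ?_, ?_⟩
  · filter_upwards [hb] with x hx using (hx y₀ (Metric.mem_ball_self one_pos)).1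
  · filter_upwards [hb] with x hx y hy using (hx y hy).2
  · have h1 := ((Λ x).hasFDerivAt (x := y)).cexp.mul_const (Φ x)
    refine h1.congr_fderiv ?_
    ext v
    simp
    ring
  · refine continuousAt_of_dominated (bound := fun x => K * ‖Φ x‖) (Eventually.of_forall hm') ?_ hbi
      (Eventually.of_forall fun x => Continuous.continuousAt (by fun_prop))
    filter_upwards [hball] with y hy
    filter_upwards [hb] with x hx using (hx y hy).2
  · refine hbi.mono' (hm' y₀) ?_
    filter_upwards [hb] with x hx using (hx y₀ (Metric.mem_ball_self one_pos)).2

theorem contDiff_integral_cexp (hΛ : Continuous Λ) (hΦ : Integrable Φ μ)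
    (h0 : ∀ᵐ x ∂μ, r < ‖x‖ → Φ x = 0) : ContDiff ℝ 1 fun y => ∫ x, cexp (Λ x y) * Φ x ∂μ := by
  refine contDiff_one_iff_fderiv.2
    ⟨fun y => (hasFDerivAt_integral_cexp hΛ hΦ h0 y).1.differentiableAt, ?_⟩
  have e1 : fderiv ℝ (fun y => ∫ x, cexp (Λ x y) * Φ x ∂μ) =
      fun y => ∫ x, (cexp (Λ x y) * Φ x) • Λ x ∂μ :=
    funext fun y => (hasFDerivAt_integral_cexp hΛ hΦ h0 y).1.fderiv
  rw [e1]
  exact continuous_iff_continuousAt.2 fun y => (hasFDerivAt_integral_cexp hΛ hΦ h0 y).2.1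

theorem fderiv_integral_cexp_apply (hΛ : Continuous Λ) (hΦ : Integrable Φ μ)
    (h0 : ∀ᵐ x ∂μ, r < ‖x‖ → Φ x = 0) (y v : E) :
    fderiv ℝ (fun y => ∫ x, cexp (Λ x y) * Φ x ∂μ) y v =
      ∫ x, (cexp (Λ x y) * Φ x) * Λ x v ∂μ := by
  obtain ⟨h1, -, h3⟩ := hasFDerivAt_integral_cexp hΛ hΦ h0 y
  rw [h1.fderiv, ContinuousLinearMap.integral_apply h3]
  rfl

end Parametric

/-! ### The normalized measure and its Plancherel identity -/

section NormMeasure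

variable {n : ℕ} {E : Type*} [NormedAddCommGroup E]

/-- The normalizing factor `(2π)^{-n/2}`. -/
noncomputable def normConst (n : ℕ) : ℝ := (2 * Real.pi) ^ (-(n : ℝ) / 2)

theorem normConst_pos (n : ℕ) : 0 < normConst n := Real.rpow_pos_of_pos (by positivity) _

/-- The square of the normalizing factor cancels the Jacobian of the rescaling by 2π, which is why
Plancherel holds with constant one. -/
theorem normConst_sq_mul (n : ℕ) : normConst n ^ 2 * (2 * Real.pi) ^ n = 1 := by
  rw [normConst, ← Real.rpow_natCast, ← Real.rpow_natCast, ← Real.rpow_mul (by positivity),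
    ← Real.rpow_add (by positivity)]
  simp

theorem normMeasure_eq (n : ℕ) :
    normMeasure n = ENNReal.ofReal (normConst n) • (volume : Measure (Rn n)) := rfl

theorem ofReal_normConst_ne_zero (n : ℕ) : ENNReal.ofReal (normConst n) ≠ 0 := by
  simpa using normConst_pos n

theorem volume_eq_smul_normMeasure (n : ℕ) :
    (volume : Measure (Rn n)) = (ENNReal.ofReal (normConst n))⁻¹ • normMeasure n := by
  rw [normMeasure_eq, smul_smul, ENNReal.inv_mul_cancel (ofReal_normConst_ne_zero n)
    ENNReal.ofReal_ne_top, one_smul]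

theorem ae_normMeasure_iff {p : Rn n → Prop} :
    (∀ᵐ x ∂(normMeasure n), p x) ↔ ∀ᵐ x, p x := by
  rw [normMeasure_eq, Measure.ae_ennreal_smul_measure_iff (ofReal_normConst_ne_zero n)]

theorem memLp_normMeasure_iff {f : Rn n → E} {p : ℝ≥0∞} :
    MemLp f p (normMeasure n) ↔ MemLp f p volume := by
  refine ⟨fun h => ?_, fun h => h.smul_measure ENNReal.ofReal_ne_top⟩
  rw [volume_eq_smul_normMeasure]
  exact h.smul_measure (ENNReal.inv_ne_top.2 (ofReal_normConst_ne_zero n))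

theorem integrable_normMeasure_iff {f : Rn n → E} :
    Integrable f (normMeasure n) ↔ Integrable f volume := by
  rw [← memLp_one_iff_integrable, ← memLp_one_iff_integrable, memLp_normMeasure_iff]

theorem integral_normMeasure [NormedSpace ℝ E] (f : Rn n → E) :
    ∫ x, f x ∂(normMeasure n) = normConst n • ∫ x, f x := by
  rw [normMeasure_eq, integral_smul_measure, ENNReal.toReal_ofReal (normConst_pos n).le]

theorem lintegral_normMeasure (f : Rn n → ℝ≥0∞) :
    ∫⁻ x, f x ∂(normMeasure n) = ENNReal.ofReal (normConst n) * ∫⁻ x, f x := by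
  rw [normMeasure_eq, lintegral_smul_measure, smul_eq_mul]

theorem VanishesOutsideBall.ae {F : Rn n → G n} {A : ℝ} (h : VanishesOutsideBall F A) :
    ∀ᵐ x ∂(normMeasure n), A < ‖x‖ → F x = 0 :=
  Filter.Eventually.mono h fun x hx hA => hx (by simpa using hA)

theorem integrable_of_vanishes {F : Rn n → E} {A : ℝ} (hF : MemLp F 2 (normMeasure n))
    (h0 : ∀ᵐ x ∂(normMeasure n), A < ‖x‖ → F x = 0) : Integrable F (normMeasure n) := by
  refine integrable_of_memLp_two (s := Metric.closedBall 0 A) ?_ hF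
    (h0.mono fun x hx h => hx (by simpa using h))
  rw [normMeasure_eq, Measure.smul_apply, smul_eq_mul]
  exact ENNReal.mul_ne_top ENNReal.ofReal_ne_top measure_closedBall_lt_top.ne

theorem lintegral_comp_smul_signFlip {s : Fin n → ℝ} {f : Rn n → ℝ≥0∞} (hf : Measurable f) :
    ∫⁻ y, f ((2 * Real.pi)⁻¹ • signFlip s y) = ENNReal.ofReal ((2 * Real.pi) ^ n) * ∫⁻ y, f y := by
  have h1 : ∫⁻ y, f ((2 * Real.pi)⁻¹ • signFlip s y) = ∫⁻ y, f ((2 * Real.pi)⁻¹ • y) :=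
    (signFlip s).measurePreserving.lintegral_comp (f := fun y => f ((2 * Real.pi)⁻¹ • y))
      (hf.comp (measurable_const_smul _))
  rw [h1, ← lintegral_map hf (measurable_const_smul ((2 * Real.pi)⁻¹)),
    Measure.map_addHaar_smul _ (by positivity), lintegral_smul_measure, finrank_euclideanSpace,
    Fintype.card_fin, inv_pow, inv_inv, abs_of_pos (by positivity), smul_eq_mul]

/-- Plancherel's theorem for the scalar transform, with the normalized measure. -/
theorem lintegral_enorm_sq_transform {s : Fin n → ℝ} {Φ : Rn n → ℂ} {y' : Rn n}
    (h1 : Integrable (fun x => expKernel x 0 y' * Φ x) (normMeasure n))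
    (h2 : MemLp (fun x => expKernel x 0 y' * Φ x) 2 (normMeasure n)) :
    ∫⁻ y, ‖∫ x, expKernel x ((2 * Real.pi)⁻¹ • signFlip s y) y' * Φ x ∂(normMeasure n)‖ₑ ^ 2
      ∂(normMeasure n) = ∫⁻ x, ‖expKernel x 0 y' * Φ x‖ₑ ^ 2 ∂(normMeasure n) := by
  rw [integrable_normMeasure_iff] at h1
  rw [memLp_normMeasure_iff] at h2
  have e1 : ∀ y, ∫ x, expKernel x y y' * Φ x ∂(normMeasure n) =
      normConst n • 𝓕 (fun x => expKernel x 0 y' * Φ x) y := fun y => by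
    rw [integral_normMeasure, Real.fourier_eq]
    congr 1
    refine integral_congr_ae (Eventually.of_forall fun x => ?_)
    simp only [Circle.smul_def, Real.fourierChar_apply, expKernel, smul_eq_mul]
    rw [← mul_assoc, ← Complex.exp_add]
    congr 2
    simp
    ring
  have hm : Measurable fun y => ‖𝓕 (fun x => expKernel x 0 y' * Φ x) y‖ₑ ^ 2 :=
    (PaleyWiener.continuous_fourier h1).measurable.enorm.pow_const 2
  simp only [e1, enorm_smul, mul_pow]
  rw [lintegral_normMeasure, lintegral_const_mul' _ _ (by finiteness),
    lintegral_comp_smul_signFlip hm, lintegral_enorm_sq_fourier h1 h2, lintegral_normMeasure]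
  congr 1
  rw [← mul_assoc, Real.enorm_of_nonneg (normConst_pos n).le,
    ← ENNReal.ofReal_pow (normConst_pos n).le, ← ENNReal.ofReal_mul (by positivity),
    normConst_sq_mul, ENNReal.ofReal_one, one_mul]

end NormMeasure

end CliffordFourier

namespace CliffordFourier

open PaleyWiener Complex Filter Topology
open scoped RealInnerProductSpace

/-! ### Monogenicity as Cauchy–Riemann equations -/

section Coordinates

variable {n : ℕ} {ι : Type} [Fintype ι] (T : BivFamily n ι)

/-- The coordinates as continuous linear maps. -/
noncomputable def coordL (j : ι) : G n →L[ℝ] ℂ := LinearMap.toContinuousLinearMap (T.coord j)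

/-- The inclusions as continuous linear maps. -/
noncomputable def inclL (j : ι) : ℂ →L[ℝ] G n := LinearMap.toContinuousLinearMap (T.incl j)

theorem coordL_apply (j : ι) (a : G n) : coordL T j a = T.coord j a := rfl

theorem inclL_apply (j : ι) (w : ℂ) : inclL T j w = T.incl j w := rfl

/-- The exponent of the scalar kernel, `Σ x_i (y'_i - i s_i y_i)`. -/
noncomputable def exponent (s : Fin n → ℝ) (x : Rn n) : R2n n →L[ℝ] ℂ :=
  ∑ i, (x i : ℂ) • (ofRealCLM ∘L EuclideanSpace.proj (Sum.inr i) -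
    (I * s i) • (ofRealCLM ∘L EuclideanSpace.proj (Sum.inl i)))

theorem continuous_exponent (s : Fin n → ℝ) : Continuous (exponent (n := n) s) := by
  unfold exponent
  fun_prop

theorem exponent_apply (s : Fin n → ℝ) (x : Rn n) (y : R2n n) :
    exponent s x y = ∑ i, (x i : ℂ) * (y (Sum.inr i) - I * s i * y (Sum.inl i)) := by
  simp [exponent]

theorem exponent_basisVec_inl (s : Fin n → ℝ) (x : Rn n) (i : Fin n) :
    exponent s x (basisVec (Sum.inl i)) = -(I * s i * x i) := by
  rw [exponent_apply, Finset.sum_eq_single i]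
  · simp [basisVec]; ring
  · intro k _ hk
    simp [basisVec, hk]
  · simp

theorem exponent_basisVec_inr (s : Fin n → ℝ) (x : Rn n) (i : Fin n) :
    exponent s x (basisVec (Sum.inr i)) = x i := by
  rw [exponent_apply, Finset.sum_eq_single i]
  · simp [basisVec]
  · intro k _ hk
    simp [basisVec, hk]
  · simp

theorem cexp_exponent (j : ι) (x y y' : Rn n) :
    cexp (exponent (T.sign j) x (pt y y')) =
      expKernel x ((2 * Real.pi)⁻¹ • signFlip (T.sign j) y) ((2 * Real.pi)⁻¹ • y') := by
  rw [two_pi_expKernel, ← sum_sign_eq_inner, exponent_apply]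
  congr 1
  simp only [mul_sub, Finset.sum_sub_distrib, pt, Sum.elim_inl, Sum.elim_inr]
  congr 1
  · simp [PiLp.inner_apply, mul_comm]
  · refine Finset.sum_congr rfl fun i _ => ?_
    push_cast
    ring

theorem coord_kernel_mul' (j : ι) (x : Rn n) (y : R2n n) (a : G n) :
    T.coord j (kernel x y * a) = cexp (exponent (T.sign j) x y) * T.coord j a := by
  rw [← pt_unprimed_primed y, coord_kernel_mul, cexp_exponent]

/-- Left multiplication by the invertible e_i turns the equation into ∂f/∂y_i + B_i ∂f/∂y'_i = 0. In
a coordinate with sign s, where B_i acts as i s, this is the Cauchy–Riemann equation for the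
variable y'_i - i s y_i. -/
theorem monogenic_iff_coord {f : R2n n → G n} {y : R2n n} (i : Fin n)
    (hf : DifferentiableAt ℝ f y) :
    vectorDeriv i f y = 0 ↔ ∀ j, fderiv ℝ (fun y => T.coord j (f y)) y (basisVec (Sum.inl i)) =
      -(I * T.sign j i * fderiv ℝ (fun y => T.coord j (f y)) y (basisVec (Sum.inr i))) := by
  have h1 : ∀ j v, fderiv ℝ (fun y => T.coord j (f y)) y v = T.coord j (fderiv ℝ f y v) :=
    fun j v => by
      have := ((coordL T j).hasFDerivAt.comp y hf.hasFDerivAt).fderiv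
      exact congrArg (fun L => L v) this
  set X : G n := fderiv ℝ f y (basisVec (Sum.inl i)) + biv i * fderiv ℝ f y (basisVec (Sum.inr i))
    with hX
  have h2 : vectorDeriv i f y = e i * X := by
    rw [vectorDeriv, hX, mul_add, ← mul_assoc, e_mul_biv]
  have h3 : vectorDeriv i f y = 0 ↔ X = 0 := by
    refine ⟨fun h => ?_, fun h => by rw [h2, h, mul_zero]⟩
    rw [← one_mul X, ← e_mul_self i, mul_assoc, ← h2, h, mul_zero]
  have h4 : X = 0 ↔ ∀ j, T.coord j X = 0 :=
    ⟨fun h j => by rw [h, map_zero], eq_zero_of_coord T⟩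
  rw [h3, h4]
  refine forall_congr' fun j => ?_
  rw [hX, map_add, coord_biv_mul, h1, h1, eq_neg_iff_add_eq_zero]

end Coordinates

/-! ### Transforms of functions supported in the ball -/

section Direct

variable {n : ℕ} {ι : Type} [Fintype ι] (T : BivFamily n ι) {F : Rn n → G n} {A : ℝ}

theorem memLp_coord (hF : MemLp F 2 (normMeasure n)) (j : ι) :
    MemLp (fun x => T.coord j (F x)) 2 (normMeasure n) :=
  (coordL T j).comp_memLp' hF

theorem ae_coord_eq_zero (hv : VanishesOutsideBall F A) (j : ι) :
    ∀ᵐ x ∂(normMeasure n), A < ‖x‖ → T.coord j (F x) = 0 :=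
  hv.ae.mono fun x hx h => by rw [hx h, map_zero]

theorem integrable_coord (hF : MemLp F 2 (normMeasure n)) (hv : VanishesOutsideBall F A) (j : ι) :
    Integrable (fun x => T.coord j (F x)) (normMeasure n) :=
  integrable_of_vanishes (memLp_coord T hF j) (ae_coord_eq_zero T hv j)

include T in
theorem transformExists (hF : MemLp F 2 (normMeasure n)) (hv : VanishesOutsideBall F A)
    (y : R2n n) : TransformExists F y := by
  have h1 : (fun x => kernel x y * F x) = fun x => ∑ j, inclL T j (expKernel x
      ((2 * Real.pi)⁻¹ • signFlip (T.sign j) (unprimed y)) ((2 * Real.pi)⁻¹ • primed y) *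
        T.coord j (F x)) := by
    ext x
    rw [← T.sum_incl (kernel x y * F x)]
    refine Finset.sum_congr rfl fun j _ => ?_
    rw [inclL_apply, ← coord_kernel_mul, pt_unprimed_primed]
  rw [TransformExists, h1]
  exact integrable_finsetSum _ fun j _ => (inclL T j).integrable_comp
    (integrable_expKernel_mul (integrable_coord T hF hv j) (ae_coord_eq_zero T hv j) _ _)

theorem coord_extTransform (hF : MemLp F 2 (normMeasure n)) (hv : VanishesOutsideBall F A)
    (j : ι) (y : R2n n) : T.coord j (extTransform F y) =
      ∫ x, cexp (exponent (T.sign j) x y) * T.coord j (F x) ∂(normMeasure n) := by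
  have : CompleteSpace (G n) := FiniteDimensional.complete ℝ (G n)
  rw [extTransform, ← coordL_apply,
    ← (coordL T j).integral_comp_comm (transformExists T hF hv y)]
  simp only [coordL_apply, coord_kernel_mul']

theorem coord_extTransform_pt (hF : MemLp F 2 (normMeasure n)) (hv : VanishesOutsideBall F A)
    (j : ι) (y y' : Rn n) : T.coord j (extTransform F (pt y y')) =
      ∫ x, expKernel x ((2 * Real.pi)⁻¹ • signFlip (T.sign j) y) ((2 * Real.pi)⁻¹ • y') *
        T.coord j (F x) ∂(normMeasure n) := by
  rw [coord_extTransform T hF hv]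
  simp only [cexp_exponent]

include T in
theorem isMonogenic_extTransform (hF : MemLp F 2 (normMeasure n)) (hv : VanishesOutsideBall F A)
    (i : Fin n) : IsMonogenic i (extTransform F) := by
  have hu : ∀ j, (fun y => T.coord j (extTransform F y)) = fun y =>
      ∫ x, cexp (exponent (T.sign j) x y) * T.coord j (F x) ∂(normMeasure n) :=
    fun j => funext fun y => coord_extTransform T hF hv j y
  have hC : ContDiff ℝ 1 (extTransform F) := by
    have h1 : extTransform F = fun y => ∑ j, inclL T j (T.coord j (extTransform F y)) :=
      funext fun y => (T.sum_incl _).symm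
    rw [h1]
    refine ContDiff.sum fun j _ => (inclL T j).contDiff.comp ?_
    rw [hu j]
    exact contDiff_integral_cexp (continuous_exponent _) (integrable_coord T hF hv j)
      (ae_coord_eq_zero T hv j)
  refine ⟨hC, fun y => (monogenic_iff_coord T i (hC.differentiable one_ne_zero y)).2 fun j => ?_⟩
  rw [hu j, fderiv_integral_cexp_apply (continuous_exponent _) (integrable_coord T hF hv j)
      (ae_coord_eq_zero T hv j), fderiv_integral_cexp_apply (continuous_exponent _)
      (integrable_coord T hF hv j) (ae_coord_eq_zero T hv j), ← integral_const_mul, ← integral_neg]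
  refine integral_congr_ae (Eventually.of_forall fun x => ?_)
  simp only [exponent_basisVec_inl, exponent_basisVec_inr]
  ring

include T in
theorem exists_expBound_extTransform (hA : 0 < A) (hF : MemLp F 2 (normMeasure n))
    (hv : VanishesOutsideBall F A) : ∃ C : ℝ, 0 < C ∧ ExpBound (extTransform F) A C := by
  set K := ∑ j, ∫ x, ‖T.coord j (F x)‖ ∂(normMeasure n) with hK
  have hK0 : 0 ≤ K := Finset.sum_nonneg fun j _ => integral_nonneg fun x => norm_nonneg _
  -- The summand 1 keeps the constant positive when F vanishes.
  refine ⟨K + 1, by linarith, fun y => ?_⟩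
  have h1 : ∀ j, ‖T.coord j (extTransform F y)‖ ≤
      Real.exp (A * ‖y‖) * ∫ x, ‖T.coord j (F x)‖ ∂(normMeasure n) := fun j => by
    rw [← pt_unprimed_primed y, coord_extTransform_pt T hF hv, ← integral_const_mul]
    refine norm_integral_le_of_norm_le ((integrable_coord T hF hv j).norm.const_mul _) ?_
    filter_upwards [norm_expKernel_mul_le (ae_coord_eq_zero T hv j)] with x hx
    refine (hx _ _).trans (mul_le_mul_of_nonneg_right (Real.exp_le_exp.2 ?_) (norm_nonneg _))
    rw [norm_smul, Real.norm_of_nonneg (by positivity)]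
    calc 2 * Real.pi * (A * ((2 * Real.pi)⁻¹ * ‖primed y‖)) = A * ‖primed y‖ := by field_simp
      _ ≤ _ := mul_le_mul_of_nonneg_left (norm_le_norm_pt _ _) hA.le
  calc ‖extTransform F y‖ ≤ ∑ j, ‖T.coord j (extTransform F y)‖ := norm_le_sum_coord T _
    _ ≤ ∑ j, Real.exp (A * ‖y‖) * ∫ x, ‖T.coord j (F x)‖ ∂(normMeasure n) :=
      Finset.sum_le_sum fun j _ => h1 j
    _ = K * Real.exp (A * ‖y‖) := by rw [← Finset.mul_sum, mul_comm]
    _ ≤ (K + 1) * Real.exp (A * ‖y‖) := by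
      have := Real.exp_nonneg (A * ‖y‖)
      nlinarith

include T in
-- Plancherel applies to each coordinate of e^{x·y'} F, and the exponential is at most e^{A|y'|} on
-- the ball. The squares add up by Parseval's identity, so no further constant is lost.
theorem eLpNorm_slice_extTransform_le (hA : 0 < A) (hF : MemLp F 2 (normMeasure n))
    (hv : VanishesOutsideBall F A) (y' : Rn n) :
    eLpNorm (slice (extTransform F) y') 2 (normMeasure n) ≤
      ENNReal.ofReal (Real.exp (A * ‖y'‖)) * eLpNorm F 2 (normMeasure n) := by
  have hcont : Continuous (extTransform F) := by
    have h1 : extTransform F = fun y => ∑ j, inclL T j (T.coord j (extTransform F y)) :=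
      funext fun y => (T.sum_incl _).symm
    rw [h1]
    refine continuous_finsetSum _ fun j _ => (inclL T j).continuous.comp ?_
    rw [funext fun y => coord_extTransform T hF hv j y]
    exact (contDiff_integral_cexp (continuous_exponent _) (integrable_coord T hF hv j)
      (ae_coord_eq_zero T hv j)).continuous
  set z := (2 * Real.pi)⁻¹ • y' with hz
  have hbound : ∀ j, ∀ᵐ x ∂(normMeasure n), ‖expKernel x 0 z * T.coord j (F x)‖ ≤
      Real.exp (A * ‖y'‖) * ‖T.coord j (F x)‖ := fun j => by
    filter_upwards [norm_expKernel_mul_le (ae_coord_eq_zero T hv j)] with x hx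
    refine (hx 0 z).trans_eq ?_
    rw [hz, norm_smul, Real.norm_of_nonneg (by positivity)]
    congr 2
    field_simp
  have hint := fun j => integrable_expKernel_mul (integrable_coord T hF hv j)
    (ae_coord_eq_zero T hv j) 0 z
  have hj : ∀ j, ∫⁻ y, ‖T.coord j (slice (extTransform F) y' y)‖ₑ ^ 2 ∂(normMeasure n) ≤
      ENNReal.ofReal (Real.exp (A * ‖y'‖)) ^ 2 *
        ∫⁻ x, ‖T.coord j (F x)‖ₑ ^ 2 ∂(normMeasure n) := fun j => by
    simp only [slice, coord_extTransform_pt T hF hv, ← hz]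
    rw [lintegral_enorm_sq_transform (hint j)
      ((memLp_coord T hF j).of_le_mul (hint j).1 (hbound j)),
      ← lintegral_const_mul' _ _ (by finiteness)]
    refine lintegral_mono_ae ((hbound j).mono fun x hx => ?_)
    rw [← mul_pow, ← ofReal_norm, ← ofReal_norm, ← ENNReal.ofReal_mul (by positivity)]
    exact pow_le_pow_left' (ENNReal.ofReal_le_ofReal hx) 2
  have hm : ∀ {H : Rn n → G n}, AEStronglyMeasurable H (normMeasure n) → ∀ j,
      AEMeasurable (fun x => ‖T.coord j (H x)‖ₑ ^ 2) (normMeasure n) := fun hH j =>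
    (((coordL T j).continuous.comp_aestronglyMeasurable hH).enorm).pow_const 2
  have hsl : Continuous (slice (extTransform F) y') :=
    hcont.comp (continuous_pt.comp (f := fun y : Rn n => (y, y')) (by fun_prop))
  have hsq : eLpNorm (slice (extTransform F) y') 2 (normMeasure n) ^ 2 ≤
      (ENNReal.ofReal (Real.exp (A * ‖y'‖)) * eLpNorm F 2 (normMeasure n)) ^ 2 := by
    rw [mul_pow, eLpNorm_two_sq, eLpNorm_two_sq]
    simp only [← sum_enorm_sq T]
    rw [lintegral_finsetSum' _ fun j _ => hm hsl.aestronglyMeasurable j,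
      lintegral_finsetSum' _ fun j _ => hm hF.1 j, Finset.mul_sum]
    exact Finset.sum_le_sum fun j _ => hj j
  exact (ENNReal.pow_le_pow_left_iff two_ne_zero).1 hsq

end Direct

end CliffordFourier

namespace PaleyWiener

open Filter Topology Complex

variable {V : Type*} [NormedAddCommGroup V] [InnerProductSpace ℝ V]
  [FiniteDimensional ℝ V] [MeasurableSpace V] [BorelSpace V] {g : V → V → ℂ} {A C : ℝ}

/-- The Paley–Wiener theorem when some slice is square integrable. -/
theorem exists_eq_integral_expKernel_of_memLp_slice (hA : 0 ≤ A)
    (hc : Continuous fun p : V × V => g p.1 p.2) (hg : EntireOnLines g) (hgr : ExpGrowth g A C)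
    (v : V) (hv : MemLp (g · v) 2) :
    ∃ G : V → ℂ, MemLp G 2 ∧ (∀ᵐ x, A / (2 * Real.pi) < ‖x‖ → G x = 0) ∧
      ∀ y y', g y y' = ∫ x, expKernel x y y' * G x := by
  -- Translating y' by `v` costs a factor e^{A|v|} in the growth constant. It is undone by
  -- multiplying `G` by e^{-2π x·v}, which is bounded on the ball outside which `G` vanishes.
  obtain ⟨G, hG, hG0, hGg⟩ := exists_eq_integral_expKernel (g := fun y y' => g y (v + y'))
    (C := C * Real.exp (A * ‖v‖)) hA
    (hc.comp (f := fun p : V × V => (p.1, v + p.2)) (by fun_prop))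
    (fun y y' ω => by simpa only [add_assoc] using hg y (v + y') ω)
    (fun y y' => by
      refine (hgr _ _).trans ?_
      rw [mul_assoc, ← Real.exp_add]
      refine mul_le_mul_of_nonneg_left (Real.exp_le_exp.2 ?_) hgr.nonneg
      rw [← mul_add]
      exact mul_le_mul_of_nonneg_left (by linarith [norm_add_le v y']) hA)
    (by simpa using hv)
  have hm : Continuous fun x : V => expKernel x 0 (-v) :=
    continuous_expKernel.comp (f := fun x : V => (x, 0, -v)) (by fun_prop)
  refine ⟨fun x => expKernel x 0 (-v) * G x, ?_, hG0.mono fun x hx h => by simp [hx h],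
    fun y y' => ?_⟩
  · exact hG.of_le_mul (hm.aestronglyMeasurable.mul hG.1)
      ((norm_expKernel_mul_le hG0).mono fun x hx => hx 0 (-v))
  · have h := hGg y (-v + y')
    rw [add_neg_cancel_left] at h
    rw [h]
    congr 1 with x
    have := expKernel_add x y y' 0 (-v)
    rw [add_zero, add_comm y'] at this
    rw [this, mul_assoc]

end PaleyWiener

namespace CliffordFourier

open PaleyWiener Complex Filter Topology
open scoped RealInnerProductSpace

/-! ### Representation of monogenic functions -/

section Converse

variable {n : ℕ} {ι : Type} [Fintype ι] (T : BivFamily n ι) {f : R2n n → G n} {A C : ℝ}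

/-- The rescaled coordinates of `f`, as functions of `y` and `y'`. -/
noncomputable def scaledCoord (f : R2n n → G n) (j : ι) (y y' : Rn n) : ℂ :=
  T.coord j (f (pt ((2 * Real.pi) • signFlip (T.sign j) y) ((2 * Real.pi) • y')))

theorem coord_eq_scaledCoord (j : ι) (y y' : Rn n) : T.coord j (f (pt y y')) =
    scaledCoord T f j ((2 * Real.pi)⁻¹ • signFlip (T.sign j) y) ((2 * Real.pi)⁻¹ • y') := by
  have h : 2 * Real.pi ≠ 0 := by positivity
  rw [scaledCoord, map_smul, signFlip_signFlip (T.sign_eq j), smul_inv_smul₀ h, smul_inv_smul₀ h]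

theorem continuous_scaledCoord (hf : Continuous f) (j : ι) :
    Continuous fun p : Rn n × Rn n => scaledCoord T f j p.1 p.2 :=
  (coordL T j).continuous.comp (hf.comp (continuous_pt.comp
    (f := fun p : Rn n × Rn n => ((2 * Real.pi) • signFlip (T.sign j) p.1, (2 * Real.pi) • p.2))
    (by fun_prop)))

theorem expGrowth_scaledCoord (hA : 0 ≤ A) (hC : 0 ≤ C) (hf : ExpBound f A C) (j : ι) :
    ExpGrowth (scaledCoord T f j) (2 * Real.pi * A) C := by
  intro y y'
  refine (norm_coord_le T j _).trans ((hf _).trans ?_)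
  refine mul_le_mul_of_nonneg_left (Real.exp_le_exp.2 ?_) hC
  rw [mul_comm (2 * Real.pi), mul_assoc]
  refine mul_le_mul_of_nonneg_left ((norm_pt_le _ _).trans_eq ?_) hA
  rw [norm_smul, norm_smul, LinearIsometryEquiv.norm_map, Real.norm_of_nonneg (by positivity),
    mul_add]

theorem memLp_scaledCoord {v : Rn n} (hv : MemLp (slice f v) 2 (normMeasure n)) (j : ι) :
    MemLp (fun y => scaledCoord T f j y ((2 * Real.pi)⁻¹ • v)) 2 := by
  have h : (2 * Real.pi) ≠ 0 := by positivity
  have h1 : MemLp (fun y => T.coord j (slice f v y)) 2 volume :=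
    (coordL T j).comp_memLp' (memLp_normMeasure_iff.1 hv)
  have h2 : MemLp (fun y => T.coord j (slice f v ((2 * Real.pi) • y))) 2 volume := by
    refine MemLp.comp_of_map (g := fun y => T.coord j (slice f v y))
      (f := fun y : Rn n => (2 * Real.pi) • y) ?_ (measurable_const_smul _).aemeasurable
    rw [Measure.map_addHaar_smul _ h]
    exact h1.smul_measure ENNReal.ofReal_ne_top
  have h3 := h2.comp_measurePreserving (signFlip (T.sign j)).measurePreserving
  refine h3.ae_eq (Eventually.of_forall fun y => ?_)
  simp only [scaledCoord, smul_inv_smul₀ h]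
  rfl

theorem pt_zero_smul (ω : Rn n) (c : ℝ) :
    pt 0 (c • ω) = ∑ i, (c * ω i) • (basisVec (Sum.inr i) : R2n n) := by
  ext k
  rcases k with k | k
  · simp [pt, basisVec]
  · simp [pt, basisVec, Pi.single_apply]

theorem pt_smul_zero (ω : Rn n) (c : ℝ) :
    pt (c • ω) 0 = ∑ i, (c * ω i) • (basisVec (Sum.inl i) : R2n n) := by
  ext k
  rcases k with k | k
  · simp [pt, basisVec, Pi.single_apply]
  · simp [pt, basisVec]

/-- The line is the image of ℂ under a real affine map sending the directions 1 and i to `a` and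
`b`. It suffices that the derivative along `b` is i times that along `a`: this is the combination of
the Cauchy–Riemann equations with weights 2πω_i, the sign flip contributing a second factor s_i and
s_i² = 1. -/
theorem entireOnLines_scaledCoord (hf : ∀ i, IsMonogenic i f) (hf1 : ContDiff ℝ 1 f) (j : ι) :
    EntireOnLines (scaledCoord T f j) := by
  intro y y' ω w₀
  set u : R2n n → ℂ := fun z => T.coord j (f z) with hu
  have hud : Differentiable ℝ u :=
    (coordL T j).differentiable.comp (hf1.differentiable one_ne_zero)
  set a : R2n n := pt 0 ((2 * Real.pi) • ω) with ha
  set b : R2n n := pt ((-(2 * Real.pi)) • signFlip (T.sign j) ω) 0 with hb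
  set p : R2n n := pt ((2 * Real.pi) • signFlip (T.sign j) y) ((2 * Real.pi) • y') with hp
  let L : ℂ →L[ℝ] R2n n := reCLM.smulRight a + imCLM.smulRight b
  have hL : ∀ w, L w = w.re • a + w.im • b := fun w => rfl
  have hL1 : L 1 = a := by simp [hL]
  have hLI : L I = b := by simp [hL]
  have hline : (fun w : ℂ => scaledCoord T f j (y - w.im • ω) (y' + w.re • ω)) =
      fun w => u (p + L w) := by
    ext w
    rw [hu, scaledCoord, hL]
    congr 2
    ext k
    rcases k with k | k
    · simp [pt, ha, hb, hp, mul_sub]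
      ring
    · simp [pt, ha, hb, hp]
      ring
  rw [hline, differentiableAt_complex_iff_differentiableAt_real]
  have hder : HasFDerivAt (fun w => u (p + L w)) ((fderiv ℝ u (p + L w₀)).comp L) w₀ :=
    (hud _).hasFDerivAt.comp w₀ (L.hasFDerivAt.const_add p)
  refine ⟨hder.differentiableAt, ?_⟩
  rw [hder.fderiv, ContinuousLinearMap.comp_apply, ContinuousLinearMap.comp_apply, hLI, hL1, ha, hb,
    pt_zero_smul, pt_smul_zero, map_sum, map_sum, Finset.smul_sum]
  refine Finset.sum_congr rfl fun i _ => ?_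
  have hmon := (monogenic_iff_coord T i (hf1.differentiable one_ne_zero _)).1
    ((hf i).2 (p + L w₀)) j
  rw [map_smul, map_smul, hmon, signFlip_apply (T.sign_eq j)]
  have hs : ((T.sign j i : ℝ) : ℂ) * T.sign j i = 1 := by
    rcases T.sign_eq j i with h | h <;> simp [h]
  simp only [real_smul, smul_eq_mul]
  push_cast
  linear_combination (2 * Real.pi * ω i * I *
    fderiv ℝ u (p + L w₀) (basisVec (Sum.inr i))) * hs

include T in
theorem exists_eq_extTransform (hA : 0 < A) (hC : 0 ≤ C) (hf : ∀ i, IsMonogenic i f)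
    (hf1 : ContDiff ℝ 1 f) (hfb : ExpBound f A C) {v : Rn n}
    (hv : MemLp (slice f v) 2 (normMeasure n)) :
    ∃ F : Rn n → G n, MemLp F 2 (normMeasure n) ∧ VanishesOutsideBall F A ∧
      ∀ y, TransformExists F y ∧ f y = extTransform F y := by
  have : CompleteSpace (G n) := FiniteDimensional.complete ℝ (G n)
  have hPW := fun j => exists_eq_integral_expKernel_of_memLp_slice (A := 2 * Real.pi * A)
    (by positivity) (continuous_scaledCoord T hf1.continuous j)
    (entireOnLines_scaledCoord T hf hf1 j) (expGrowth_scaledCoord T hA.le hC hfb j) _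
    (memLp_scaledCoord T hv j)
  choose H hH2 hH0 hHf using hPW
  have hH0' : ∀ j, ∀ᵐ x, A < ‖x‖ → H j x = 0 := fun j => by
    have h := hH0 j
    rwa [mul_div_cancel_left₀ _ (by positivity)] at h
  have hH0m : ∀ j, ∀ᵐ x ∂(normMeasure n), A < ‖x‖ → H j x = 0 :=
    fun j => ae_normMeasure_iff.2 (hH0' j)
  have hH2m : ∀ j, MemLp (H j) 2 (normMeasure n) := fun j => memLp_normMeasure_iff.2 (hH2 j)
  -- The factor cancels the normalization of the measure. Since coordinates may be redundant, `H j`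
  -- need not be a coordinate of `F` up to scale; the kernel's action on the inclusions
  -- (`kernel_mul_incl`) makes this irrelevant.
  set F : Rn n → G n := fun x => ∑ j, (normConst n)⁻¹ • inclL T j (H j x) with hF
  have hF2 : MemLp F 2 (normMeasure n) :=
    memLp_finsetSum _ fun j _ => by
      exact ((inclL T j).comp_memLp' (hH2m j)).const_smul (normConst n)⁻¹
  have hF0 : VanishesOutsideBall F A := by
    filter_upwards [ae_all_iff.2 hH0m] with x hx h
    refine Finset.sum_eq_zero fun j _ => ?_
    rw [hx j (by simpa using h), map_zero, smul_zero]
  refine ⟨F, hF2, hF0, fun y => ⟨transformExists T hF2 hF0 y, ?_⟩⟩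
  obtain ⟨y₁, y₂, rfl⟩ : ∃ y₁ y₂, pt y₁ y₂ = y := ⟨_, _, pt_unprimed_primed y⟩
  set K : ι → Rn n → ℂ := fun j x => expKernel x
    ((2 * Real.pi)⁻¹ • signFlip (T.sign j) y₁) ((2 * Real.pi)⁻¹ • y₂) * H j x with hK
  have hKi : ∀ j, Integrable (K j) (normMeasure n) := fun j =>
    integrable_expKernel_mul (integrable_of_vanishes (hH2m j) (hH0m j)) (hH0m j) _ _
  have hKF : ∀ x, kernel x (pt y₁ y₂) * F x = ∑ j, (normConst n)⁻¹ • inclL T j (K j x) := by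
    intro x
    rw [hF, Finset.mul_sum]
    refine Finset.sum_congr rfl fun j _ => ?_
    rw [mul_smul_comm, inclL_apply, kernel_mul_incl, inclL_apply]
  have hKc : ∀ j, ∫ x, K j x = T.coord j (f (pt y₁ y₂)) := fun j => by
    rw [coord_eq_scaledCoord, hHf j]
  rw [extTransform]
  simp only [hKF]
  have hKs : ∀ j, Integrable (fun x => (normConst n)⁻¹ • inclL T j (K j x)) (normMeasure n) :=
    fun j => ((inclL T j).integrable_comp (hKi j)).smul (normConst n)⁻¹
  rw [integral_finsetSum _ fun j _ => hKs j, ← T.sum_incl (f (pt y₁ y₂))]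
  refine Finset.sum_congr rfl fun j _ => ?_
  rw [integral_smul, (inclL T j).integral_comp_comm (hKi j), integral_normMeasure, map_smul,
    inv_smul_smul₀ (normConst_pos n).ne', hKc, inclL_apply]

end Converse

end CliffordFourier

open CliffordFourier in
theorem theorem4p4 (n : ℕ) (A : ℝ) (hA : 0 < A) :
    (∀ F : Rn n → G n, MemLp F 2 (normMeasure n) → VanishesOutsideBall F A →
      (∀ y, TransformExists F y) ∧
      (∀ i, IsMonogenic i (extTransform F)) ∧
      (∃ C : ℝ, 0 < C ∧ ExpBound (extTransform F) A C) ∧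
      (∀ y' : Rn n, eLpNorm (slice (extTransform F) y') 2 (normMeasure n) ≤
        ENNReal.ofReal (Real.exp (A * ‖y'‖)) * eLpNorm F 2 (normMeasure n))) ∧
    (∀ (C : ℝ) (f : R2n n → G n) (h : Rn n → ℝ), 0 < C →
      (∀ i, IsMonogenic i f) → ExpBound f A C → LocallyIntegrable h volume →
      (∀ᵐ y' ∂(volume : Measure (Rn n)),
        eLpNorm (slice f y') 2 (normMeasure n) ^ 2 ≤ ENNReal.ofReal (h y')) →
      ∃ F : Rn n → G n, MemLp F 2 (normMeasure n) ∧ VanishesOutsideBall F A ∧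
        ∀ y, TransformExists F y ∧ f y = extTransform F y) := by
  obtain ⟨ι, _, ⟨T⟩⟩ := exists_bivFamily n
  refine ⟨fun F hF hv => ⟨transformExists T hF hv, isMonogenic_extTransform T hF hv,
    exists_expBound_extTransform T hA hF hv, eLpNorm_slice_extTransform_le T hA hF hv⟩,
    fun C f h hC hf hfb _ hh => ?_⟩
  have hf1 : ContDiff ℝ 1 f := by
    -- For n = 0 there is no index from which to read off regularity, but the domain is a single
    -- point.
    rcases n with _ | n
    · have : f = fun _ => f 0 := funext fun x => congrArg f (Subsingleton.elim _ _)
      rw [this]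
      exact contDiff_const
    · exact (hf 0).1
  obtain ⟨v, hv⟩ := hh.exists
  have hsl : Continuous (slice f v) :=
    hf1.continuous.comp (continuous_pt.comp (f := fun y : Rn n => (y, v)) (by fun_prop))
  refine exists_eq_extTransform T hA hC.le hf hf1 hfb (v := v) ⟨hsl.aestronglyMeasurable, ?_⟩
  have : eLpNorm (slice f v) 2 (normMeasure n) ^ 2 < ∞ := hv.trans_lt ENNReal.ofReal_lt_top
  simpa using this
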